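/- Let $d\ge 2$ and let $v:(0,\infty)\to\mathbb{R}$ be $C^1$, with $v'(r)>0$ for all $r\ge R_0$, for some $R_0>0$. Write $a\approx b$ if there is $C>0$ with $\frac1C\le \frac ab\le C$ (near the indicated limit). Assume that either $v$ extends continuously to $[0,\infty)$, or $$(\mathrm S)\qquad v(r)\approx -r^{-s}\ \text{ as } r\to 0^+ \text{ for some } s\in(0,2).$$ Assume moreover that one of the following two cases holds. * Case A: there is $m>1$ such that $v(r)\approx r^m$ and $v'(r)\approx r^{m-1}$ as $r\to+\infty$. * Case B: there is $m\in(-2,0)$ such that $v(r)\approx -r^m$ and $v'(r)\approx r^{m-1}$ as $r\to+\infty$. Put $V(x)=v(|x|)$ on $\mathbb{R}^d$ and let $H_V=-\Delta+V$ be the Friedrichs extension, i.e. the self-adjoint operator associated with the form $\int\nabla u\cdot\nabla\varphi+\int Vu\varphi$ on the form domain of those $u\in H^1(\mathbb{R}^d)$ for which $|V|^{1/2}u$ is square integrable outside some ball centred at $0$ (in Case B this is all of $H^1(\mathbb{R}^d)$). Eigenfunctions are real-valued, are not identically zero, and are identified with their continuous representatives. A nodal domain of $u$ is a connected component of $\{x\in\mathbb{R}^d: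 u(x)\neq0\}$, and $B(0,\rho)$ is the open ball of radius $\rho$ centred at $0$. 1. Suppose that (S) holds and $d\ge3$. Then there are constants $c_d>0$ and $\lambda_0>0$, depending only on $V$ and $d$, such that for every $\lambda\ge\lambda_0$ and every eigenfunction $u_\lambda$ of $H_V$ with eigenvalue $\lambda$, no nodal domain of $u_\lambda$ is contained in $B(0,c_d\lambda^{-1/2})$. 2. Suppose that (S) holds and $d=2$. Then there is a constant $c_V>0$, depending only on $V$, such that for every $\epsilon>0$ there is $\lambda_\epsilon>0$ such that for every $\lambda\ge\lambda_\epsilon$ and every eigenfunction $u_\lambda$ of $H_V$ with eigenvalue $\lambda$, no nodal domain of $u_\lambda$ is contained in $B(0,c_V\lambda^{-1/2-\epsilon})$. 3. Suppose that Case B holds and $d\ge2$. Then there is $r_d>0$ (depending only on $V$ and $d$) such that for every $\lambda<0$ and every eigenfunction $u_\lambda$ of $H_V$ with eigenvalue $\lambda$, no nodal domain of $u_\lambda$ is contained in $B(0,r_d)$. -/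

import Mathlib

open MeasureTheory Filter Topology Set
open scoped ContDiff

namespace RadialSchrodinger

/-- `a ≈ b` along the filter `l`: for some `C > 0`, eventually `1 / C ≤ a / b ≤ C`. -/
def Comparable (l : Filter ℝ) (a b : ℝ → ℝ) : Prop :=
  ∃ C : ℝ, 0 < C ∧ ∀ᶠ r in l, 1 / C ≤ a r / b r ∧ a r / b r ≤ C

/-- The singular behaviour `v(r) ≈ -r^{-s}` as `r → 0⁺`, for some `s ∈ (0, 2)`. -/
def SingularAtZero (v : ℝ → ℝ) : Prop :=
  ∃ s : ℝ, 0 < s ∧ s < 2 ∧ Comparable (𝓝[>] 0) v (fun r => -(r ^ (-s)))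

/-- The assumptions on the radial profile `v` common to the two cases: `v` is `C¹` on `(0, ∞)`,
`v' > 0` near infinity, and `v` is either continuous up to `0` or has the singular behaviour
`v(r) ≈ -r^{-s}` there. -/
structure RadialProfile (v : ℝ → ℝ) : Prop where
  contDiffOn : ContDiffOn ℝ 1 v (Ioi 0)
  deriv_pos : ∃ R₀ : ℝ, 0 < R₀ ∧ ∀ r, R₀ ≤ r → 0 < deriv v r
  at_zero : ContinuousOn v (Ici 0) ∨ SingularAtZero v

/-- Case A: `v(r) ≈ r^m` and `v'(r) ≈ r^{m-1}` at infinity, for some `m > 1`. -/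
def CaseA (v : ℝ → ℝ) : Prop :=
  RadialProfile v ∧ ∃ m : ℝ, 1 < m ∧
    Comparable atTop v (fun r => r ^ m) ∧ Comparable atTop (deriv v) (fun r => r ^ (m - 1))

/-- Case B: `v(r) ≈ -r^m` and `v'(r) ≈ r^{m-1}` at infinity, for some `m ∈ (-2, 0)`. -/
def CaseB (v : ℝ → ℝ) : Prop :=
  RadialProfile v ∧ ∃ m : ℝ, -2 < m ∧ m < 0 ∧
    Comparable atTop v (fun r => -(r ^ m)) ∧ Comparable atTop (deriv v) (fun r => r ^ (m - 1))

variable {d : ℕ}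

/-- `G` is the weak (distributional) gradient of `u` on `ℝ^d`. -/
structure IsWeakGradient (u : EuclideanSpace ℝ (Fin d) → ℝ)
    (G : EuclideanSpace ℝ (Fin d) → EuclideanSpace ℝ (Fin d)) : Prop where
  locallyIntegrable : LocallyIntegrable u
  locallyIntegrable_grad : LocallyIntegrable G
  integral_eq : ∀ φ : EuclideanSpace ℝ (Fin d) → ℝ, ContDiff ℝ ∞ φ → HasCompactSupport φ →
    ∀ w : EuclideanSpace ℝ (Fin d),
      ∫ x, u x * fderiv ℝ φ x w = -∫ x, inner ℝ (G x) w * φ x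

/-- `u ∈ H¹(ℝ^d)`, with weak gradient `G`. -/
structure MemH1With (u : EuclideanSpace ℝ (Fin d) → ℝ)
    (G : EuclideanSpace ℝ (Fin d) → EuclideanSpace ℝ (Fin d)) : Prop where
  memLp : MemLp u 2
  memLp_grad : MemLp G 2
  isWeakGradient : IsWeakGradient u G

/-- `u`, with weak gradient `G`, lies in the form domain of the Friedrichs extension of `-Δ + V`,
`V(x) = v(|x|)`: `u ∈ H¹(ℝ^d)`, and `|V|^{1/2} u` is square integrable outside some ball. Since `V`
is bounded on compact subsets of `ℝ^d ∖ {0}`, the choice of the ball is immaterial; if `V` is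
bounded at infinity (Case B) the last condition always holds and the form domain is `H¹(ℝ^d)`. -/
def MemFormDomainWith (v : ℝ → ℝ) (u : EuclideanSpace ℝ (Fin d) → ℝ)
    (G : EuclideanSpace ℝ (Fin d) → EuclideanSpace ℝ (Fin d)) : Prop :=
  MemH1With u G ∧
    ∃ R : ℝ, 0 < R ∧ IntegrableOn (fun x => v ‖x‖ * u x ^ 2) (Metric.ball 0 R)ᶜ

/-- `u` belongs to the domain of the self-adjoint operator `H_V = -Δ + V` associated with the
quadratic form, and `H_V u = f`: `u` is in the form domain, `f ∈ L²`, and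
`∫ ∇u · ∇φ + ∫ V u φ = ∫ f φ` for every `φ` in the form domain. -/
def IsImage (v : ℝ → ℝ) (u f : EuclideanSpace ℝ (Fin d) → ℝ) : Prop :=
  MemLp f 2 ∧ ∃ G : EuclideanSpace ℝ (Fin d) → EuclideanSpace ℝ (Fin d),
    MemFormDomainWith v u G ∧
    ∀ (φ : EuclideanSpace ℝ (Fin d) → ℝ)
      (Γ : EuclideanSpace ℝ (Fin d) → EuclideanSpace ℝ (Fin d)), MemFormDomainWith v φ Γ →
      (∫ x, inner ℝ (G x) (Γ x)) + (∫ x, v ‖x‖ * u x * φ x) = ∫ x, f x * φ x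

/-- `u` is an eigenfunction of `H_V` for the eigenvalue `lam`: `u ≠ 0` in `L²` and
`H_V u = lam u`. Eigenfunctions are taken through their continuous representative, the one
whose zero set and nodal domains are meant. -/
structure IsEigenfunction (v : ℝ → ℝ) (lam : ℝ) (u : EuclideanSpace ℝ (Fin d) → ℝ) : Prop where
  continuous : Continuous u
  ne_zero : ¬ (u =ᵐ[volume] 0)
  eigen : IsImage v u (fun x => lam * u x)

/-- `D` is a nodal domain of `u`: a connected component of the complement of the zero set. -/
def IsNodalDomain (u : EuclideanSpace ℝ (Fin d) → ℝ) (D : Set (EuclideanSpace ℝ (Fin d))) : Prop :=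
  ∃ x, u x ≠ 0 ∧ D = connectedComponentIn {y | u y ≠ 0} x

end RadialSchrodinger

/-! Suppose a nodal domain `D` lies in a ball of radius ρ on which |V| ≤ C|x|^(-s), 0 ≤ s < 2, and
let u be positive on `D` (otherwise pass to -u). Testing the eigenvalue equation with u restricted
to `D` bounds ∫_D |∇u|² by ∫_D W u², where W = λ⁺ + C|x|^(-s). A Hardy inequality on the ball bounds
∫_D |x|^(-s) u² by (2/(d-s))² ρ^(2-s) ∫_D |∇u|²; its case s = 0 is a Poincaré inequality. Together
they give ∫_D W u² ≤ θ ∫_D W u² with θ = λ⁺ (2/d)² ρ² + C (2/(d-s))² ρ^(2-s). If θ < 1 then u = 0 on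
`D`, a contradiction (`IsEigenfunction.not_subset_ball`).

For large λ, taking ρ of order λ^(-1/2) keeps the first term below a fixed constant and sends the
second to 0. For λ < 0 the first term is absent and ρ is independent of λ. Since s < 2 ≤ d, the
Hardy inequality is subcritical in dimension 2 as well, so the planar statement with ε follows from
the same bound.

The boundary of `D` may be irregular, so u is replaced on `D` by φ(u), with φ a C¹ function
vanishing below a level δ > 0. This is compactly supported in `D`, and a chain rule for weak
gradients, proved by mollification, makes it an admissible test function. The level δ tends to 0 at
the end. -/

namespace RadialSchrodinger

open scoped Convolution
open ContinuousLinearMap (lsmul)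

variable {d : ℕ}

/-! ### Mollification and the chain rule for weak gradients -/

/-- The mollification of `u` by the normalised bump function `η`. -/
noncomputable def mollify (η : ContDiffBump (0 : EuclideanSpace ℝ (Fin d)))
    (u : EuclideanSpace ℝ (Fin d) → ℝ) : EuclideanSpace ℝ (Fin d) → ℝ :=
  η.normed volume ⋆[lsmul ℝ ℝ, volume] u

lemma contDiff_mollify (η : ContDiffBump (0 : EuclideanSpace ℝ (Fin d)))
    {u : EuclideanSpace ℝ (Fin d) → ℝ} (hu : LocallyIntegrable u) : ContDiff ℝ 1 (mollify η u) :=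
  η.hasCompactSupport_normed.contDiff_convolution_left (n := 1) _ η.contDiff_normed hu

/-- The derivative is put on the bump, and y ↦ η(x - y) is an admissible test function for the weak
gradient. The reflection in y cancels the minus sign of the definition. -/
lemma fderiv_mollify {u : EuclideanSpace ℝ (Fin d) → ℝ}
    {G : EuclideanSpace ℝ (Fin d) → EuclideanSpace ℝ (Fin d)} (h : IsWeakGradient u G)
    (η : ContDiffBump (0 : EuclideanSpace ℝ (Fin d))) (x w : EuclideanSpace ℝ (Fin d)) :
    fderiv ℝ (mollify η u) x w = ∫ y, inner ℝ (G y) w * η.normed volume (x - y) := by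
  have hη : ContDiff ℝ ∞ (η.normed (volume : Measure (EuclideanSpace ℝ (Fin d)))) :=
    η.contDiff_normed
  have hη1 : ContDiff ℝ 1 (η.normed (volume : Measure (EuclideanSpace ℝ (Fin d)))) :=
    η.contDiff_normed (n := 1)
  have hcs := η.hasCompactSupport_normed (μ := (volume : Measure (EuclideanSpace ℝ (Fin d))))
  have e : mollify η u = u ⋆[(lsmul ℝ ℝ : ℝ →L[ℝ] ℝ →L[ℝ] ℝ).flip, volume] η.normed volume :=
    (convolution_flip _).symm
  rw [e, (hcs.hasFDerivAt_convolution_right _ h.locallyIntegrable hη1 x).fderiv,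
    convolution_precompR_apply _ h.locallyIntegrable (hcs.fderiv ℝ)
      (hη1.continuous_fderiv one_ne_zero)]
  set ψ : EuclideanSpace ℝ (Fin d) → ℝ := fun y => η.normed volume (x - y) with hψ
  have hψs : ContDiff ℝ ∞ ψ := hη.comp (contDiff_const.sub contDiff_id)
  have hψc : HasCompactSupport ψ := hcs.comp_homeomorph (Homeomorph.subLeft x)
  have key := h.integral_eq ψ hψs hψc w
  have hd : ∀ y, fderiv ℝ ψ y w = - fderiv ℝ (η.normed volume) (x - y) w := by
    intro y
    have h1 : HasFDerivAt ψ ((fderiv ℝ (η.normed volume) (x - y)).comp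
        (-ContinuousLinearMap.id ℝ _)) y :=
      HasFDerivAt.comp y (hη1.differentiable one_ne_zero _).hasFDerivAt
        ((hasFDerivAt_id y).const_sub x)
    rw [h1.fderiv]; simp
  simp only [hd, mul_neg, integral_neg, neg_inj] at key
  rw [← key, convolution_def]
  simp [mul_comm]

lemma tendsto_mollify {u : EuclideanSpace ℝ (Fin d) → ℝ} (hu : Continuous u) {ι : Type*}
    {η : ι → ContDiffBump (0 : EuclideanSpace ℝ (Fin d))} {l : Filter ι}
    (hη : Tendsto (fun i => (η i).rOut) l (𝓝 0)) (x : EuclideanSpace ℝ (Fin d)) :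
    Tendsto (fun p : ι × EuclideanSpace ℝ (Fin d) => mollify (η p.1) u p.2) (l ×ˢ 𝓝 x)
      (𝓝 (u x)) :=
  ContDiffBump.convolution_tendsto_right (φ := fun p : ι × EuclideanSpace ℝ (Fin d) => η p.1)
    (g := fun _ => u) (k := fun p => p.2) (hη.comp tendsto_fst)
    (Eventually.of_forall fun _ => hu.aestronglyMeasurable)
    ((hu.tendsto x).comp tendsto_snd) tendsto_snd

/-- The crude factor 3 is M for |u(x)| plus 2M for the oscillation of u around x. Only a bound
uniform in the bump is needed, for dominated convergence. -/
lemma abs_mollify_le {u : EuclideanSpace ℝ (Fin d) → ℝ} (hu : Continuous u)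
    (η : ContDiffBump (0 : EuclideanSpace ℝ (Fin d))) {M : ℝ} {x : EuclideanSpace ℝ (Fin d)}
    (hM : ∀ y ∈ Metric.closedBall x η.rOut, |u y| ≤ M) : |mollify η u x| ≤ 3 * M := by
  have hx := hM x (Metric.mem_closedBall_self η.rOut_pos.le)
  have h := η.dist_normed_convolution_le (μ := volume) (x₀ := x) (g := u) (ε := 2 * M)
    hu.aestronglyMeasurable fun y hy => by
      have := hM y (Metric.ball_subset_closedBall hy)
      rw [Real.dist_eq]
      linarith [abs_sub (u y) (u x)]
  rw [Real.dist_eq] at h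
  have := abs_sub_abs_le_abs_sub (mollify η u x) (u x)
  unfold mollify at *
  linarith

/-- Fubini: the mollifier is self-adjoint. -/
lemma integral_mollify_swap {g q : EuclideanSpace ℝ (Fin d) → ℝ}
    (η : ContDiffBump (0 : EuclideanSpace ℝ (Fin d))) (hg : Continuous g)
    (hgc : HasCompactSupport g) (hq : LocallyIntegrable q) :
    ∫ x, (∫ y, q y * η.normed volume (x - y)) * g x = ∫ y, q y * mollify η g y := by
  have hη : Continuous (η.normed (volume : Measure (EuclideanSpace ℝ (Fin d)))) :=
    η.continuous_normed
  obtain ⟨M, hM⟩ : ∃ M, ∀ x, ‖η.normed (volume : Measure (EuclideanSpace ℝ (Fin d))) x‖ ≤ M :=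
    η.hasCompactSupport_normed.exists_bound_of_continuous hη
  set K := Metric.cthickening η.rOut (tsupport g)
  have hK : IsCompact K := hgc.isCompact.cthickening
  have hqK : Integrable (K.indicator q) :=
    (integrable_indicator_iff hK.measurableSet).2 (hq.integrableOn_isCompact hK)
  have hint : Integrable (Function.uncurry fun x y => q y * η.normed volume (x - y) * g x)
      (volume.prod volume) := by
    have h1 : Integrable (fun p : EuclideanSpace ℝ (Fin d) × EuclideanSpace ℝ (Fin d) =>
        (M * ‖g p.1‖) * ‖K.indicator q p.2‖) (volume.prod volume) :=
      ((hg.integrable_of_hasCompactSupport hgc).norm.const_mul M).mul_prod hqK.norm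
    refine h1.mono' ?_ (Eventually.of_forall ?_)
    · exact ((hq.aestronglyMeasurable.comp_snd).mul
        (hη.comp (continuous_fst.sub continuous_snd)).aestronglyMeasurable).mul
        (hg.comp continuous_fst).aestronglyMeasurable
    · rintro ⟨x, y⟩
      simp only [Function.uncurry_apply_pair, norm_mul]
      by_cases hx : x ∈ tsupport g
      · by_cases hxy : η.normed volume (x - y) = 0
        · rw [hxy]; simp only [norm_zero, mul_zero, zero_mul]
          have : 0 ≤ M := (norm_nonneg _).trans (hM 0)
          positivity
        · have hy : y ∈ K := by
            have : x - y ∈ Function.support (η.normed volume) := hxy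
            rw [η.support_normed_eq, mem_ball_zero_iff] at this
            refine Metric.mem_cthickening_of_dist_le y x _ _ hx ?_
            rw [dist_comm, dist_eq_norm]; exact this.le
          rw [indicator_of_mem hy]
          calc ‖q y‖ * ‖η.normed volume (x - y)‖ * ‖g x‖ ≤ ‖q y‖ * M * ‖g x‖ := by
                gcongr; exact hM _
            _ = _ := by ring
      · rw [image_eq_zero_of_notMem_tsupport hx]; simp
  simp_rw [← integral_mul_const]
  rw [integral_integral_swap hint]
  refine integral_congr_ae (Eventually.of_forall fun y => ?_)
  simp only [mul_assoc, integral_const_mul]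
  congr 1
  unfold mollify
  rw [convolution_eq_swap]
  simp only [ContinuousLinearMap.lsmul_apply, smul_eq_mul]
  refine integral_congr_ae (Eventually.of_forall fun x => ?_)
  simp only
  rw [← η.normed_neg (x - y), neg_sub]

lemma exists_contDiffBump_seq (d : ℕ) :
    ∃ η : ℕ → ContDiffBump (0 : EuclideanSpace ℝ (Fin d)),
      Tendsto (fun n => (η n).rOut) atTop (𝓝 0) ∧ ∀ n, (η n).rOut ≤ 1 := by
  refine ⟨fun n => ⟨1 / ((n : ℝ) + 1) / 2, 1 / ((n : ℝ) + 1), by positivity,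
    half_lt_self (by positivity)⟩, tendsto_one_div_add_atTop_nhds_zero_nat, fun n => ?_⟩
  change 1 / ((n : ℝ) + 1) ≤ 1
  rw [div_le_one (by positivity)]
  linarith [Nat.cast_nonneg (α := ℝ) n]

/-- Chain rule for weak gradients of continuous functions, in the weak form. -/
lemma IsWeakGradient.integral_comp_mul_fderiv {u : EuclideanSpace ℝ (Fin d) → ℝ}
    {G : EuclideanSpace ℝ (Fin d) → EuclideanSpace ℝ (Fin d)} (h : IsWeakGradient u G)
    (hu : Continuous u) {Φ Φ' : ℝ → ℝ} (hΦ : ∀ t, HasDerivAt Φ (Φ' t) t) (hΦ' : Continuous Φ')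
    {ψ : EuclideanSpace ℝ (Fin d) → ℝ} (hψ : ContDiff ℝ 1 ψ) (hψc : HasCompactSupport ψ)
    (w : EuclideanSpace ℝ (Fin d)) :
    ∫ x, Φ (u x) * fderiv ℝ ψ x w = -∫ x, inner ℝ (G x) w * (Φ' (u x) * ψ x) := by
  have hΦc : Continuous Φ := continuous_iff_continuousAt.2 fun t => (hΦ t).continuousAt
  have hΦ1 : ContDiff ℝ 1 Φ := by
    rw [contDiff_one_iff_deriv]
    exact ⟨fun t => (hΦ t).differentiableAt, by rwa [funext fun t => (hΦ t).deriv]⟩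
  obtain ⟨η, hη0, hη1⟩ := exists_contDiffBump_seq d
  let U : ℕ → EuclideanSpace ℝ (Fin d) → ℝ := fun n => mollify (η n) u
  have hU1 : ∀ n, ContDiff ℝ 1 (U n) := fun n => contDiff_mollify _ h.locallyIntegrable
  have hψd : Continuous fun x => fderiv ℝ ψ x w :=
    (hψ.continuous_fderiv one_ne_zero).clm_apply continuous_const
  have hψdc : HasCompactSupport fun x => fderiv ℝ ψ x w := hψc.fderiv_apply ℝ w
  have hq : LocallyIntegrable fun x => inner ℝ (G x) w := by
    rw [locallyIntegrable_iff]
    intro K hK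
    exact (h.locallyIntegrable_grad.integrableOn_isCompact hK).inner_const w
  let g : ℕ → EuclideanSpace ℝ (Fin d) → ℝ := fun n x => Φ' (U n x) * ψ x
  have hg : ∀ n, Continuous (g n) := fun n =>
    (hΦ'.comp (hU1 n).continuous).mul hψ.continuous
  have hgc : ∀ n, HasCompactSupport (g n) := fun n => hψc.mul_left
  -- For the smooth mollified function, classical integration by parts and the classical chain rule
  -- apply. The mollifier is then moved from `G` onto the continuous factor `g n`, so that no
  -- convergence of mollified gradients is needed.
  have key : ∀ n, ∫ x, Φ (U n x) * fderiv ℝ ψ x w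
      = -∫ y, inner ℝ (G y) w * mollify (η n) (g n) y := by
    intro n
    have hd : ∀ x, fderiv ℝ (fun x => Φ (U n x)) x w = Φ' (U n x) * fderiv ℝ (U n) x w := by
      intro x
      have := (hΦ (U n x)).comp_hasFDerivAt x ((hU1 n).differentiable one_ne_zero x).hasFDerivAt
      have e : fderiv ℝ (fun x => Φ (U n x)) x = Φ' (U n x) • fderiv ℝ (U n) x := this.fderiv
      rw [e]; rfl
    have hc : ContDiff ℝ 1 (fun x => Φ (U n x)) := hΦ1.comp (hU1 n)
    rw [integral_mul_fderiv_eq_neg_fderiv_mul_of_integrable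
      (f := fun x => Φ (U n x)) (g := ψ) (v := w) ?_ ?_ ?_
      (fun x _ => hc.differentiable one_ne_zero x) (fun x _ => hψ.differentiable one_ne_zero x)]
    · rw [← integral_mollify_swap (η n) (hg n) (hgc n) hq]
      congr 1
      refine integral_congr_ae (Eventually.of_forall fun x => ?_)
      simp only [hd, g]
      rw [show fderiv ℝ (U n) x w = _ from fderiv_mollify h (η n) x w]
      ring
    · exact (((hc.continuous_fderiv one_ne_zero).clm_apply continuous_const).mul
        hψ.continuous).integrable_of_hasCompactSupport hψc.mul_left
    · exact (hc.continuous.mul hψd).integrable_of_hasCompactSupport hψdc.mul_left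
    · exact (hc.continuous.mul hψ.continuous).integrable_of_hasCompactSupport hψc.mul_left
  -- All bumps have radius at most 1, so everything takes place in this one compact set, on which u
  -- is bounded.
  set K := Metric.cthickening 1 (tsupport ψ)
  have hK : IsCompact K := hψc.isCompact.cthickening
  have hball : ∀ n, ∀ x ∈ tsupport ψ, ∀ y ∈ Metric.closedBall x (η n).rOut, y ∈ K :=
    fun n x hx y hy => Metric.mem_cthickening_of_dist_le y x _ _ hx
      ((Metric.mem_closedBall.1 hy).trans (hη1 n))
  obtain ⟨M, hM⟩ := hK.exists_bound_of_continuousOn hu.continuousOn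
  have hUM : ∀ n, ∀ x ∈ tsupport ψ, U n x ∈ Icc (-(3 * M)) (3 * M) := fun n x hx =>
    abs_le.1 (abs_mollify_le hu (η n) fun y hy => hM y (hball n x hx y hy))
  obtain ⟨C₁, hC₁⟩ := (isCompact_Icc (a := -(3 * M)) (b := 3 * M)).exists_bound_of_continuousOn
    hΦc.continuousOn
  obtain ⟨C₂, hC₂⟩ := (isCompact_Icc (a := -(3 * M)) (b := 3 * M)).exists_bound_of_continuousOn
    hΦ'.continuousOn
  obtain ⟨C₃, hC₃⟩ := hψc.exists_bound_of_continuous hψ.continuous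
  have hUt : ∀ x, Tendsto (fun p : ℕ × EuclideanSpace ℝ (Fin d) => U p.1 p.2) (atTop ×ˢ 𝓝 x)
      (𝓝 (u x)) := fun x => tendsto_mollify hu hη0 x
  have hUp : ∀ x, Tendsto (fun n => U n x) atTop (𝓝 (u x)) := fun x =>
    ContDiffBump.convolution_tendsto_right_of_continuous hη0 hu x
  have lim1 : Tendsto (fun n => ∫ x, Φ (U n x) * fderiv ℝ ψ x w) atTop
      (𝓝 (∫ x, Φ (u x) * fderiv ℝ ψ x w)) := by
    refine tendsto_integral_of_dominated_convergence (fun x => C₁ * ‖fderiv ℝ ψ x w‖)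
      (fun n => ((hΦc.comp (hU1 n).continuous).mul hψd).aestronglyMeasurable)
      ((hψd.integrable_of_hasCompactSupport hψdc).norm.const_mul _)
      (fun n => Eventually.of_forall fun x => ?_)
      (Eventually.of_forall fun x => ((hΦc.tendsto _).comp (hUp x)).mul_const _)
    rw [norm_mul]
    by_cases hx : x ∈ tsupport ψ
    · gcongr; exact hC₁ _ (hUM n x hx)
    · have : fderiv ℝ ψ x = 0 := image_eq_zero_of_notMem_tsupport
        fun hx' => hx (tsupport_fderiv_subset ℝ hx')
      simp [this]
  have lim2 : Tendsto (fun n => ∫ y, inner ℝ (G y) w * mollify (η n) (g n) y) atTop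
      (𝓝 (∫ y, inner ℝ (G y) w * (Φ' (u y) * ψ y))) := by
    have hB : ∀ n x, |g n x| ≤ |C₂| * |C₃| := by
      intro n x
      simp only [g, abs_mul]
      by_cases hx : x ∈ tsupport ψ
      · exact mul_le_mul ((hC₂ _ (hUM n x hx)).trans (le_abs_self _))
          ((hC₃ x).trans (le_abs_self _)) (abs_nonneg _) (abs_nonneg _)
      · rw [image_eq_zero_of_notMem_tsupport hx]; simp; positivity
    refine tendsto_integral_of_dominated_convergence
      (fun y => ‖K.indicator (fun x => inner ℝ (G x) w) y‖ * (3 * (|C₂| * |C₃|)))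
      (fun n => hq.aestronglyMeasurable.mul
        (contDiff_mollify (η n) (hg n).locallyIntegrable).continuous.aestronglyMeasurable)
      (((integrable_indicator_iff hK.measurableSet).2
        (hq.integrableOn_isCompact hK)).norm.mul_const _)
      (fun n => Eventually.of_forall fun y => ?_) (Eventually.of_forall fun y => ?_)
    · rw [norm_mul]
      by_cases hy : y ∈ K
      · rw [indicator_of_mem hy]
        gcongr
        exact abs_mollify_le (hg n) (η n) fun z _ => hB n z
      · have h0 : |mollify (η n) (g n) y| ≤ 3 * 0 := abs_mollify_le (hg n) (η n) fun z hz => by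
          by_cases hz' : z ∈ tsupport ψ
          · exact absurd (hball n z hz' y (by rwa [Metric.mem_closedBall_comm])) hy
          · simp [g, image_eq_zero_of_notMem_tsupport hz']
        rw [Real.norm_eq_abs (mollify _ _ _), le_antisymm (by simpa using h0) (abs_nonneg _)]
        simp only [mul_zero]; positivity
    · refine Tendsto.const_mul _ (ContDiffBump.convolution_tendsto_right hη0
        (Eventually.of_forall fun n => (hg n).aestronglyMeasurable) ?_ tendsto_const_nhds)
      exact ((hΦ'.tendsto _).comp (hUt y)).mul ((hψ.continuous.tendsto y).comp tendsto_snd)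
  exact tendsto_nhds_unique (lim1.congr key) lim2.neg

/-! ### Truncations and localisation to a nodal domain -/

/-- A `C¹` truncation of `t ↦ max t 0`, vanishing for `t ≤ δ`, with derivative `φ'`. -/
structure IsTruncation (δ : ℝ) (φ φ' : ℝ → ℝ) : Prop where
  pos : 0 < δ
  hasDerivAt : ∀ t, HasDerivAt φ (φ' t) t
  continuous_deriv : Continuous φ'
  eq_zero : ∀ t, t ≤ δ → φ t = 0
  deriv_nonneg : ∀ t, 0 ≤ φ' t
  deriv_le_one : ∀ t, φ' t ≤ 1

lemma IsTruncation.continuous {δ : ℝ} {φ φ' : ℝ → ℝ} (h : IsTruncation δ φ φ') : Continuous φ :=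
  continuous_iff_continuousAt.2 fun t => (h.hasDerivAt t).continuousAt

/-- `D` is a bounded open set, and a union of connected components of `{u ≠ 0}` near which `u`
can be cut off. -/
structure IsNodalRegion (u : EuclideanSpace ℝ (Fin d) → ℝ) (D : Set (EuclideanSpace ℝ (Fin d))) :
    Prop where
  isOpen : IsOpen D
  isBounded : Bornology.IsBounded D
  mem_of_closure : ∀ x ∈ closure D, u x ≠ 0 → x ∈ D

/-- A connected set stays connected when a point of its closure is added, so maximality of the
component captures every closure point where u ≠ 0. In other words, u vanishes on the boundary. -/
lemma IsNodalDomain.isNodalRegion {u : EuclideanSpace ℝ (Fin d) → ℝ} (hu : Continuous u)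
    {D : Set (EuclideanSpace ℝ (Fin d))} (hD : IsNodalDomain u D) (hb : Bornology.IsBounded D) :
    IsNodalRegion u D := by
  obtain ⟨x₀, hx₀, rfl⟩ := hD
  refine ⟨(isOpen_ne_fun hu continuous_const).connectedComponentIn, hb, fun x hx hux => ?_⟩
  have hpre := (isPreconnected_connectedComponentIn (F := {y | u y ≠ 0}) (x := x₀)).subset_closure
    (subset_insert x _) (insert_subset hx subset_closure)
  exact hpre.subset_connectedComponentIn (mem_insert_of_mem _ (mem_connectedComponentIn hx₀))
    (insert_subset hux (connectedComponentIn_subset _ _)) (mem_insert _ _)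

lemma exists_contDiff_cutoff {E : Type*} [NormedAddCommGroup E] [NormedSpace ℝ E]
    [FiniteDimensional ℝ E] {s t : Set E} (hs : IsClosed s) (ht : IsClosed t)
    (hd : Disjoint s t) :
    ∃ χ : E → ℝ, ContDiff ℝ ∞ χ ∧ (∀ x ∈ s, χ =ᶠ[𝓝 x] 0) ∧ ∀ x ∈ t, χ =ᶠ[𝓝 x] 1 := by
  obtain ⟨f, h0, h1, -⟩ := exists_contMDiffMap_zero_one_nhds_of_isClosed
    (modelWithCornersSelf ℝ E) hs ht hd (n := ⊤)
  exact ⟨f, f.contMDiff.contDiff, eventually_nhdsSet_iff_forall.1 h0,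
    eventually_nhdsSet_iff_forall.1 h1⟩

/-- Since u = 0 on the boundary of `D`, the closed sets `Dᶜ` and `closure D ∩ {δ ≤ u}` are disjoint
and can be separated smoothly. For functions of u vanishing below δ, multiplying by χ then amounts
to restricting to `D`. -/
lemma IsNodalRegion.exists_cutoff {u : EuclideanSpace ℝ (Fin d) → ℝ}
    {D : Set (EuclideanSpace ℝ (Fin d))} (hD : IsNodalRegion u D) (hu : Continuous u) {δ : ℝ}
    (hδ : 0 < δ) :
    ∃ χ : EuclideanSpace ℝ (Fin d) → ℝ, ContDiff ℝ ∞ χ ∧ HasCompactSupport χ ∧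
      (∀ x, x ∉ D → χ =ᶠ[𝓝 x] 0) ∧ ∀ x ∈ D, δ ≤ u x → χ =ᶠ[𝓝 x] 1 := by
  obtain ⟨χ, hχ, h0, h1⟩ := exists_contDiff_cutoff (s := Dᶜ) (t := closure D ∩ {x | δ ≤ u x})
    hD.isOpen.isClosed_compl (isClosed_closure.inter (isClosed_le continuous_const hu))
    (by
      rw [disjoint_left]
      rintro x hx ⟨hx1, hx2⟩
      exact hx (hD.mem_of_closure x hx1 (hδ.trans_le hx2).ne'))
  refine ⟨χ, hχ, ?_, h0, fun x hx hux => h1 x ⟨subset_closure hx, hux⟩⟩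
  refine HasCompactSupport.intro hD.isBounded.isCompact_closure fun x hx => ?_
  exact (h0 x fun h => hx (subset_closure h)).self_of_nhds

lemma continuous_indicator_comp {u : EuclideanSpace ℝ (Fin d) → ℝ}
    {D : Set (EuclideanSpace ℝ (Fin d))} (hD : IsNodalRegion u D) (hu : Continuous u) {δ : ℝ}
    (hδ : 0 < δ) {Φ : ℝ → ℝ} (hΦ : Continuous Φ) (h0 : ∀ t, t ≤ δ → Φ t = 0) :
    Continuous (D.indicator fun x => Φ (u x)) ∧
      HasCompactSupport (D.indicator fun x => Φ (u x)) := by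
  obtain ⟨χ, hχ, hχc, hχ0, hχ1⟩ := hD.exists_cutoff hu hδ
  have e : (D.indicator fun x => Φ (u x)) = fun x => Φ (u x) * χ x := by
    funext x
    by_cases hx : x ∈ D
    · rw [indicator_of_mem hx]
      rcases le_total δ (u x) with h | h
      · simp [(hχ1 x hx h).self_of_nhds]
      · simp [h0 _ h]
    · simp [indicator_of_notMem hx, (hχ0 x hx).self_of_nhds]
  rw [e]
  exact ⟨(hΦ.comp hu).mul hχ.continuous, hχc.mul_left⟩

/-- The chain rule, localised to a nodal region. -/
lemma IsWeakGradient.integral_indicator_comp_mul_fderiv {u : EuclideanSpace ℝ (Fin d) → ℝ}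
    {G : EuclideanSpace ℝ (Fin d) → EuclideanSpace ℝ (Fin d)} (h : IsWeakGradient u G)
    (hu : Continuous u) {D : Set (EuclideanSpace ℝ (Fin d))} (hD : IsNodalRegion u D)
    {δ : ℝ} (hδ : 0 < δ) {Φ Φ' : ℝ → ℝ} (hΦ : ∀ t, HasDerivAt Φ (Φ' t) t) (hΦ' : Continuous Φ')
    (h0 : ∀ t, t ≤ δ → Φ t = 0) (h0' : ∀ t, t ≤ δ → Φ' t = 0)
    {ψ : EuclideanSpace ℝ (Fin d) → ℝ} (hψ : ContDiff ℝ 1 ψ) (w : EuclideanSpace ℝ (Fin d)) :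
    ∫ x, D.indicator (fun x => Φ (u x)) x * fderiv ℝ ψ x w
      = -∫ x, inner ℝ (G x) w * (D.indicator (fun x => Φ' (u x)) x * ψ x) := by
  obtain ⟨χ, hχ, hχc, hχ0, hχ1⟩ := hD.exists_cutoff hu hδ
  have hχ' : ContDiff ℝ 1 χ := hχ.of_le (by exact_mod_cast le_top)
  have key := h.integral_comp_mul_fderiv hu hΦ hΦ' (hχ'.mul hψ) hχc.mul_right w
  have hd : ∀ x, fderiv ℝ (fun x => χ x * ψ x) x w
      = χ x * fderiv ℝ ψ x w + ψ x * fderiv ℝ χ x w := by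
    intro x
    rw [fderiv_fun_mul (hχ'.differentiable one_ne_zero x) (hψ.differentiable one_ne_zero x)]
    rfl
  convert key using 2
  · funext x
    rw [hd]
    by_cases hx : x ∈ D
    · rw [indicator_of_mem hx]
      rcases le_total δ (u x) with h | h
      · rw [(hχ1 x hx h).self_of_nhds, (hχ1 x hx h).fderiv_eq]
        simp
      · simp [h0 _ h]
    · rw [indicator_of_notMem hx, (hχ0 x hx).self_of_nhds, (hχ0 x hx).fderiv_eq]
      simp
  · refine integral_congr_ae (Eventually.of_forall fun x => ?_)
    simp only
    by_cases hx : x ∈ D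
    · rw [indicator_of_mem hx]
      rcases le_total δ (u x) with h | h
      · rw [(hχ1 x hx h).self_of_nhds]
        simp
      · simp [h0' _ h]
    · rw [indicator_of_notMem hx, (hχ0 x hx).self_of_nhds]
      simp

lemma IsTruncation.deriv_eq_zero {δ : ℝ} {φ φ' : ℝ → ℝ} (h : IsTruncation δ φ φ') {t : ℝ}
    (ht : t ≤ δ) : φ' t = 0 := by
  -- One-sided derivatives from the left include the endpoint t = δ.
  have h1 : HasDerivWithinAt φ (φ' t) (Iic t) t := (h.hasDerivAt t).hasDerivWithinAt
  have h2 : HasDerivWithinAt φ 0 (Iic t) t :=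
    (hasDerivWithinAt_const t (Iic t) (0 : ℝ)).congr (fun y hy => h.eq_zero y (le_trans hy ht))
      (h.eq_zero t ht)
  exact (uniqueDiffWithinAt_Iic t).eq_deriv _ h1 h2

lemma IsTruncation.nonneg {δ : ℝ} {φ φ' : ℝ → ℝ} (h : IsTruncation δ φ φ') (t : ℝ) : 0 ≤ φ t := by
  have hm : Monotone φ := monotone_of_hasDerivAt_nonneg h.hasDerivAt h.deriv_nonneg
  rcases le_total t δ with ht | ht
  · exact (h.eq_zero t ht).ge
  · exact (h.eq_zero δ le_rfl).ge.trans (hm ht)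

/-- This makes the truncation usable as a test function in the form identity. Square integrability
of its gradient comes from 0 ≤ φ' ≤ 1. -/
lemma IsTruncation.memH1With {δ : ℝ} {φ φ' : ℝ → ℝ} (h : IsTruncation δ φ φ')
    {u : EuclideanSpace ℝ (Fin d) → ℝ}
    {G : EuclideanSpace ℝ (Fin d) → EuclideanSpace ℝ (Fin d)} (hG : MemH1With u G)
    (hu : Continuous u) {D : Set (EuclideanSpace ℝ (Fin d))} (hD : IsNodalRegion u D) :
    MemH1With (D.indicator fun x => φ (u x)) (fun x => D.indicator (fun x => φ' (u x)) x • G x) := by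
  obtain ⟨hc, hcs⟩ := continuous_indicator_comp hD hu h.pos h.continuous h.eq_zero
  obtain ⟨hc', -⟩ := continuous_indicator_comp hD hu h.pos h.continuous_deriv
    fun t ht => h.deriv_eq_zero ht
  have hL : MemLp (fun x => D.indicator (fun x => φ' (u x)) x • G x) 2 := by
    refine hG.memLp_grad.mono
      (hc'.aestronglyMeasurable.smul hG.memLp_grad.aestronglyMeasurable)
      (Eventually.of_forall fun x => ?_)
    rw [norm_smul]
    refine mul_le_of_le_one_left (norm_nonneg _) ?_
    by_cases hx : x ∈ D
    · rw [indicator_of_mem hx, Real.norm_of_nonneg (h.deriv_nonneg _)]; exact h.deriv_le_one _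
    · simp [indicator_of_notMem hx]
  refine ⟨hc.memLp_of_hasCompactSupport hcs, hL, hc.locallyIntegrable,
    hL.locallyIntegrable one_le_two, fun ψ hψ _ w => ?_⟩
  rw [hG.isWeakGradient.integral_indicator_comp_mul_fderiv hu hD h.pos h.hasDerivAt
    h.continuous_deriv h.eq_zero (fun t ht => h.deriv_eq_zero ht)
    (hψ.of_le (by exact_mod_cast le_top)) w]
  congr 1
  refine integral_congr_ae (Eventually.of_forall fun x => ?_)
  simp only [real_inner_smul_left]
  ring

/-! ### A weighted Hardy inequality on a ball -/

lemma integrableOn_ball_norm_rpow (hd : 1 ≤ d) {s : ℝ} (hs : s < d) (ρ : ℝ) :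
    IntegrableOn (fun x : EuclideanSpace ℝ (Fin d) => ‖x‖ ^ (-s)) (Metric.ball 0 ρ) := by
  refine integrableOn_ball_of_norm_le_rpow (C := 1) (α := s) (by simpa using hd) (by simpa using hs)
    (Eventually.of_forall fun x => ?_) (measurable_norm.pow_const _).aestronglyMeasurable
  rw [one_mul, Real.norm_of_nonneg (Real.rpow_nonneg (norm_nonneg _) _)]

/-- The field |x|^(-s) x behind Hardy's inequality may fail to be C¹ at 0; adding κ > 0 repairs
this, and κ tends to 0 later. -/
lemma contDiff_regularized_rpow (s : ℝ) {κ : ℝ} (hκ : 0 < κ) :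
    ContDiff ℝ 1 fun x : EuclideanSpace ℝ (Fin d) => (‖x‖ ^ 2 + κ) ^ (-s / 2) :=
  ((contDiff_norm_sq ℝ).add contDiff_const).rpow_const_of_ne fun x => by positivity

lemma sum_fderiv_regularized_rpow_mul (s : ℝ) {κ : ℝ} (hκ : 0 < κ)
    (x : EuclideanSpace ℝ (Fin d)) :
    ∑ i, fderiv ℝ (fun x : EuclideanSpace ℝ (Fin d) => (‖x‖ ^ 2 + κ) ^ (-s / 2) * x i) x
        (EuclideanSpace.single i 1)
      = d * (‖x‖ ^ 2 + κ) ^ (-s / 2) - s * ((‖x‖ ^ 2 + κ) ^ (-s / 2 - 1) * ‖x‖ ^ 2) := by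
  have hpos : ‖x‖ ^ 2 + κ ≠ 0 := by positivity
  have hh : HasFDerivAt (fun x : EuclideanSpace ℝ (Fin d) => (‖x‖ ^ 2 + κ) ^ (-s / 2))
      ((-s / 2 * (‖x‖ ^ 2 + κ) ^ (-s / 2 - 1)) • (2 • innerSL ℝ x)) x :=
    (((hasStrictFDerivAt_norm_sq x).hasFDerivAt.add_const κ).rpow_const (Or.inl hpos))
  have hi : ∀ i, fderiv ℝ (fun x : EuclideanSpace ℝ (Fin d) => (‖x‖ ^ 2 + κ) ^ (-s / 2) * x i) x
      (EuclideanSpace.single i 1)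
      = (‖x‖ ^ 2 + κ) ^ (-s / 2) - s * ((‖x‖ ^ 2 + κ) ^ (-s / 2 - 1) * x i ^ 2) := by
    intro i
    have hp : HasFDerivAt (fun x : EuclideanSpace ℝ (Fin d) => x i)
        (EuclideanSpace.proj i : EuclideanSpace ℝ (Fin d) →L[ℝ] ℝ) x :=
      (EuclideanSpace.proj i : EuclideanSpace ℝ (Fin d) →L[ℝ] ℝ).hasFDerivAt
    rw [(hh.fun_mul hp).fderiv]
    simp [EuclideanSpace.inner_single_right]
    ring
  simp_rw [hi]
  rw [Finset.sum_sub_distrib, ← Finset.mul_sum, ← Finset.mul_sum, EuclideanSpace.real_norm_sq_eq]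
  simp

/-- The exact divergence d - s of the homogeneous field survives regularisation as a lower bound,
because t² ≤ t² + κ. -/
lemma regularized_divergence_ge {s κ t : ℝ} (hs : 0 ≤ s) (hκ : 0 < κ) (n : ℝ) :
    (n - s) * (t ^ 2 + κ) ^ (-s / 2)
      ≤ n * (t ^ 2 + κ) ^ (-s / 2) - s * ((t ^ 2 + κ) ^ (-s / 2 - 1) * t ^ 2) := by
  have hpos : 0 < t ^ 2 + κ := by positivity
  have h1 : (t ^ 2 + κ) ^ (-s / 2) = (t ^ 2 + κ) ^ (-s / 2 - 1) * (t ^ 2 + κ) := by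
    rw [← Real.rpow_add_one hpos.ne']; ring_nf
  have h2 : (t ^ 2 + κ) ^ (-s / 2 - 1) * t ^ 2 ≤ (t ^ 2 + κ) ^ (-s / 2) := by
    rw [h1]; gcongr; linarith
  nlinarith [mul_le_mul_of_nonneg_left h2 hs]

lemma regularized_rpow_le {s κ t : ℝ} (hs : 0 ≤ s) (hκ : 0 ≤ κ) (ht : 0 < t) :
    (t ^ 2 + κ) ^ (-s / 2) ≤ t ^ (-s) := by
  calc (t ^ 2 + κ) ^ (-s / 2) ≤ (t ^ 2) ^ (-s / 2) :=
        Real.rpow_le_rpow_of_nonpos (by positivity) (by linarith) (by linarith)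
    _ = t ^ (-s) := by
        rw [← Real.rpow_natCast, ← Real.rpow_mul ht.le]; congr 1; push_cast; ring

lemma regularized_rpow_mul_sq_le {s κ t ρ : ℝ} (hs : 0 ≤ s) (hs2 : s < 2) (hκ : 0 ≤ κ)
    (ht : 0 ≤ t) (htρ : t ≤ ρ) : (t ^ 2 + κ) ^ (-s / 2) * t ^ 2 ≤ ρ ^ (2 - s) := by
  rcases ht.eq_or_lt with rfl | ht
  · simpa using Real.rpow_nonneg htρ _
  · calc (t ^ 2 + κ) ^ (-s / 2) * t ^ 2 ≤ t ^ (-s) * t ^ 2 := by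
          gcongr; exact regularized_rpow_le hs hκ ht
      _ = t ^ (2 - s) := by
          rw [← Real.rpow_natCast, ← Real.rpow_add ht]; congr 1; push_cast; ring
      _ ≤ ρ ^ (2 - s) := Real.rpow_le_rpow ht.le htρ (by linarith)

/-- Integration by parts against the regularised field `(|x|² + κ)^{-s/2} x`. -/
lemma IsTruncation.integral_sq_mul_divergence {δ : ℝ} {φ φ' : ℝ → ℝ} (h : IsTruncation δ φ φ')
    {u : EuclideanSpace ℝ (Fin d) → ℝ}
    {G : EuclideanSpace ℝ (Fin d) → EuclideanSpace ℝ (Fin d)} (hG : MemH1With u G)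
    (hu : Continuous u) {D : Set (EuclideanSpace ℝ (Fin d))} (hD : IsNodalRegion u D)
    (s : ℝ) {κ : ℝ} (hκ : 0 < κ) :
    let f := D.indicator fun x => φ (u x)
    let g := D.indicator fun x => φ' (u x)
    let T := fun x => (‖x‖ ^ 2 + κ) ^ (-s / 2) * (2 * (f x * g x)) * inner ℝ (G x) x
    Integrable T ∧ ∫ x, f x ^ 2 * (d * (‖x‖ ^ 2 + κ) ^ (-s / 2)
        - s * ((‖x‖ ^ 2 + κ) ^ (-s / 2 - 1) * ‖x‖ ^ 2)) = -∫ x, T x := by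
  intro f g T
  have hF : ∀ i : Fin d, ContDiff ℝ 1
      fun x : EuclideanSpace ℝ (Fin d) => (‖x‖ ^ 2 + κ) ^ (-s / 2) * x i := fun i =>
    (contDiff_regularized_rpow s hκ).mul
      (EuclideanSpace.proj i : EuclideanSpace ℝ (Fin d) →L[ℝ] ℝ).contDiff
  -- The localised chain rule is applied to φ² and to each coordinate of the field. The field need
  -- not have compact support, since f² does.
  have hΦ : ∀ t, HasDerivAt (fun t => φ t ^ 2) (2 * (φ t * φ' t)) t := fun t =>
    ((h.hasDerivAt t).fun_pow 2).congr_deriv (by push_cast; ring)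
  have hΦc : Continuous fun t => 2 * (φ t * φ' t) :=
    continuous_const.mul (h.continuous.mul h.continuous_deriv)
  have key := fun i => hG.isWeakGradient.integral_indicator_comp_mul_fderiv hu hD h.pos hΦ hΦc
    (fun t ht => by simp [h.eq_zero t ht]) (fun t ht => by simp [h.eq_zero t ht]) (hF i)
    (EuclideanSpace.single i 1)
  have e1 : (D.indicator fun x => φ (u x) ^ 2) = fun x => f x ^ 2 := by
    funext x; by_cases hx : x ∈ D <;> simp [f, hx]
  have e2 : (D.indicator fun x => 2 * (φ (u x) * φ' (u x))) = fun x => 2 * (f x * g x) := by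
    funext x; by_cases hx : x ∈ D <;> simp [f, g, hx]
  simp only [e1, e2] at key
  obtain ⟨hf, hfc⟩ := continuous_indicator_comp hD hu h.pos h.continuous h.eq_zero
  obtain ⟨hg, -⟩ := continuous_indicator_comp hD hu h.pos h.continuous_deriv
    fun t ht => h.deriv_eq_zero ht
  have hfsq : HasCompactSupport fun x => f x ^ 2 :=
    hfc.comp_left (g := fun t : ℝ => t ^ 2) (by simp)
  have int1 : ∀ i : Fin d, Integrable fun x => f x ^ 2 *
      fderiv ℝ (fun x : EuclideanSpace ℝ (Fin d) => (‖x‖ ^ 2 + κ) ^ (-s / 2) * x i) x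
        (EuclideanSpace.single i 1) := fun i => by
    have hc := ((hF i).continuous_fderiv one_ne_zero).clm_apply
      (continuous_const (y := EuclideanSpace.single i (1 : ℝ)))
    exact ((hf.pow 2).mul hc).integrable_of_hasCompactSupport hfsq.mul_right
  have int2 : ∀ i : Fin d, Integrable fun x => inner ℝ (G x) (EuclideanSpace.single i 1) *
      (2 * (f x * g x) * ((‖x‖ ^ 2 + κ) ^ (-s / 2) * x i)) := fun i => by
    have h1 : MemLp (fun x => inner ℝ (G x) (EuclideanSpace.single i (1 : ℝ))) 2 :=
      hG.memLp_grad.inner_const _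
    have h2 : MemLp (fun x => 2 * (f x * g x) * ((‖x‖ ^ 2 + κ) ^ (-s / 2) * x i)) 2 :=
      ((continuous_const.mul (hf.mul hg)).mul (hF i).continuous).memLp_of_hasCompactSupport
        (HasCompactSupport.mul_right (HasCompactSupport.mul_left (hfc.mul_right)))
    exact h1.integrable_mul h2
  have eT : ∀ x, ∑ i, inner ℝ (G x) (EuclideanSpace.single i 1) *
      (2 * (f x * g x) * ((‖x‖ ^ 2 + κ) ^ (-s / 2) * x i)) = T x := by
    intro x
    simp only [T, PiLp.inner_apply, Finset.mul_sum]
    refine Finset.sum_congr rfl fun i _ => ?_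
    simp
    ring
  refine ⟨?_, ?_⟩
  · have := integrable_finsetSum Finset.univ fun i _ => int2 i
    simpa only [eT] using this
  · simp_rw [← sum_fderiv_regularized_rpow_mul s hκ, Finset.mul_sum, ← eT]
    rw [integral_finsetSum _ fun i _ => int1 i, integral_finsetSum _ fun i _ => int2 i,
      ← Finset.sum_neg_distrib]
    exact Finset.sum_congr rfl fun i _ => key i

lemma IsTruncation.integrable_sq_mul_norm_sq {δ : ℝ} {φ φ' : ℝ → ℝ} (h : IsTruncation δ φ φ')
    {u : EuclideanSpace ℝ (Fin d) → ℝ}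
    {G : EuclideanSpace ℝ (Fin d) → EuclideanSpace ℝ (Fin d)} (hG : MemH1With u G)
    (hu : Continuous u) {D : Set (EuclideanSpace ℝ (Fin d))} (hD : IsNodalRegion u D) :
    Integrable fun x => D.indicator (fun x => φ' (u x)) x ^ 2 * ‖G x‖ ^ 2 := by
  have := (h.memH1With hG hu hD).memLp_grad.norm.integrable_sq
  simpa only [norm_smul, mul_pow, Real.norm_eq_abs, sq_abs] using this

lemma IsTruncation.hardy_regularized {δ : ℝ} {φ φ' : ℝ → ℝ} (h : IsTruncation δ φ φ')
    {u : EuclideanSpace ℝ (Fin d) → ℝ}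
    {G : EuclideanSpace ℝ (Fin d) → EuclideanSpace ℝ (Fin d)} (hG : MemH1With u G)
    (hu : Continuous u) {D : Set (EuclideanSpace ℝ (Fin d))} (hD : IsNodalRegion u D)
    {ρ : ℝ} (hρ : D ⊆ Metric.ball 0 ρ)
    {s : ℝ} (hs : 0 ≤ s) (hs2 : s < 2) (hsd : s < d) {κ : ℝ} (hκ : 0 < κ) :
    ∫ x, (‖x‖ ^ 2 + κ) ^ (-s / 2) * D.indicator (fun x => φ (u x)) x ^ 2
      ≤ (2 / (d - s)) ^ 2 * ρ ^ (2 - s) *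
        ∫ x, D.indicator (fun x => φ' (u x)) x ^ 2 * ‖G x‖ ^ 2 := by
  obtain ⟨hT, hI⟩ := h.integral_sq_mul_divergence hG hu hD s hκ
  have hJ := h.integrable_sq_mul_norm_sq hG hu hD
  obtain ⟨hf, hfc⟩ := continuous_indicator_comp hD hu h.pos h.continuous h.eq_zero
  have hsupp : ∀ x, x ∉ Metric.ball 0 ρ → D.indicator (fun x => φ' (u x)) x = 0 := fun x hx =>
    indicator_of_notMem (fun h => hx (hρ h)) _
  set f := D.indicator fun x => φ (u x)
  set g := D.indicator fun x => φ' (u x)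
  -- Weight in Young's inequality, chosen so that exactly half of the divergence term is absorbed;
  -- this produces the constant (2/(d - s))².
  set a : ℝ := (d - s) / 2 with ha
  have hapos : 0 < a := by rw [ha]; linarith
  have hfsq : HasCompactSupport fun x => f x ^ 2 :=
    hfc.comp_left (g := fun t : ℝ => t ^ 2) (by simp)
  have hreg : Continuous fun x : EuclideanSpace ℝ (Fin d) => (‖x‖ ^ 2 + κ) ^ (-s / 2) :=
    (contDiff_regularized_rpow s hκ).continuous
  have hreg' : Continuous fun x : EuclideanSpace ℝ (Fin d) => (‖x‖ ^ 2 + κ) ^ (-s / 2 - 1) :=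
    ((continuous_norm.pow 2).add continuous_const).rpow_const fun x =>
      Or.inl (by positivity : ‖x‖ ^ 2 + κ ≠ 0)
  have int1 : Integrable fun x => (‖x‖ ^ 2 + κ) ^ (-s / 2) * f x ^ 2 :=
    (hreg.mul (hf.pow 2)).integrable_of_hasCompactSupport hfsq.mul_left
  have int2 : Integrable fun x => f x ^ 2 * (d * (‖x‖ ^ 2 + κ) ^ (-s / 2)
      - s * ((‖x‖ ^ 2 + κ) ^ (-s / 2 - 1) * ‖x‖ ^ 2)) :=
    ((hf.pow 2).mul ((continuous_const.mul hreg).sub (continuous_const.mul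
      (hreg'.mul (continuous_norm.pow 2))))).integrable_of_hasCompactSupport hfsq.mul_right
  have lower : (d - s) * ∫ x, (‖x‖ ^ 2 + κ) ^ (-s / 2) * f x ^ 2
      ≤ ∫ x, f x ^ 2 * (d * (‖x‖ ^ 2 + κ) ^ (-s / 2)
        - s * ((‖x‖ ^ 2 + κ) ^ (-s / 2 - 1) * ‖x‖ ^ 2)) := by
    rw [← integral_const_mul]
    refine integral_mono (int1.const_mul _) int2 fun x => ?_
    have := mul_le_mul_of_nonneg_left (regularized_divergence_ge (t := ‖x‖) hs hκ (d : ℝ))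
      (sq_nonneg (f x))
    simp only
    linarith
  have upper : -∫ x, (‖x‖ ^ 2 + κ) ^ (-s / 2) * (2 * (f x * g x)) * inner ℝ (G x) x
      ≤ a * (∫ x, (‖x‖ ^ 2 + κ) ^ (-s / 2) * f x ^ 2)
        + a⁻¹ * ρ ^ (2 - s) * ∫ x, g x ^ 2 * ‖G x‖ ^ 2 := by
    rw [← integral_const_mul, ← integral_const_mul, ← integral_neg,
      ← integral_add (int1.const_mul _) (hJ.const_mul _)]
    refine integral_mono hT.neg ((int1.const_mul _).add (hJ.const_mul _)) fun x => ?_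
    simp only
    by_cases hx : x ∈ Metric.ball 0 ρ
    · set H := (‖x‖ ^ 2 + κ) ^ (-s / 2)
      have hH : 0 ≤ H := Real.rpow_nonneg (by positivity) _
      have h1 : H * ‖x‖ ^ 2 ≤ ρ ^ (2 - s) :=
        regularized_rpow_mul_sq_le hs hs2 hκ.le (norm_nonneg x) (mem_ball_zero_iff.1 hx).le
      set P := inner ℝ (G x) x
      have h2 : P ^ 2 ≤ ‖G x‖ ^ 2 * ‖x‖ ^ 2 := by
        rw [← mul_pow]
        exact sq_le_sq' (neg_le_of_abs_le (abs_real_inner_le_norm _ _))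
          (real_inner_le_norm _ _)
      -- Young's inequality as a completed square. The part with `P ^ 2` is controlled by
      -- Cauchy–Schwarz and `H * ‖x‖ ^ 2 ≤ ρ ^ (2 - s)`.
      have h3 : 0 ≤ H * (a⁻¹ * (a * f x + g x * P) ^ 2) := by positivity
      have h4 : a⁻¹ * (a * f x + g x * P) ^ 2
          = a * f x ^ 2 + 2 * (f x * g x) * P + a⁻¹ * (g x ^ 2 * P ^ 2) := by
        field_simp; ring
      have h5 : a⁻¹ * g x ^ 2 * H * P ^ 2 ≤ a⁻¹ * g x ^ 2 * H * (‖G x‖ ^ 2 * ‖x‖ ^ 2) := by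
        gcongr
      have h6 : a⁻¹ * g x ^ 2 * ‖G x‖ ^ 2 * (H * ‖x‖ ^ 2)
          ≤ a⁻¹ * g x ^ 2 * ‖G x‖ ^ 2 * ρ ^ (2 - s) := by gcongr
      rw [h4] at h3
      linarith
    · have : 0 ≤ a * ((‖x‖ ^ 2 + κ) ^ (-s / 2) * f x ^ 2) := by positivity
      simpa [hsupp x hx] using this
  rw [← hI] at upper
  set I := ∫ x, (‖x‖ ^ 2 + κ) ^ (-s / 2) * f x ^ 2
  set J := ∫ x, g x ^ 2 * ‖G x‖ ^ 2
  have h1 : a * I ≤ a⁻¹ * ρ ^ (2 - s) * J := by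
    have := lower.trans upper
    have h2 : (d : ℝ) - s = 2 * a := by rw [ha]; ring
    rw [h2] at this; linarith
  have h2 : 2 / ((d : ℝ) - s) = a⁻¹ := by rw [ha, inv_div]
  calc I = a⁻¹ * (a * I) := by field_simp
    _ ≤ a⁻¹ * (a⁻¹ * ρ ^ (2 - s) * J) := by gcongr
    _ = _ := by rw [h2]; ring

lemma integrable_norm_rpow_mul (hd : 1 ≤ d) {s : ℝ} (hs : s < d) {ρ M : ℝ}
    {q : EuclideanSpace ℝ (Fin d) → ℝ} (hq : AEStronglyMeasurable q)
    (hM : ∀ x, |q x| ≤ M) (h0 : ∀ x, x ∉ Metric.ball 0 ρ → q x = 0) :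
    Integrable fun x => ‖x‖ ^ (-s) * q x := by
  have h1 : Integrable ((Metric.ball (0 : EuclideanSpace ℝ (Fin d)) ρ).indicator
      fun x => ‖x‖ ^ (-s)) :=
    (integrable_indicator_iff measurableSet_ball).2 (integrableOn_ball_norm_rpow hd hs ρ)
  have h2 := h1.mul_bdd hq (Eventually.of_forall hM)
  refine h2.congr (Eventually.of_forall fun x => ?_)
  simp only
  by_cases hx : x ∈ Metric.ball 0 ρ
  · rw [indicator_of_mem hx]
  · simp [h0 x hx]

/-- A weighted Hardy inequality on small balls. -/
lemma IsTruncation.hardy {δ : ℝ} {φ φ' : ℝ → ℝ} (h : IsTruncation δ φ φ')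
    {u : EuclideanSpace ℝ (Fin d) → ℝ}
    {G : EuclideanSpace ℝ (Fin d) → EuclideanSpace ℝ (Fin d)} (hG : MemH1With u G)
    (hu : Continuous u) {D : Set (EuclideanSpace ℝ (Fin d))} (hD : IsNodalRegion u D)
    {ρ : ℝ} (hρ : D ⊆ Metric.ball 0 ρ) (hd : 1 ≤ d)
    {s : ℝ} (hs : 0 ≤ s) (hs2 : s < 2) (hsd : s < d) :
    ∫ x, ‖x‖ ^ (-s) * D.indicator (fun x => φ (u x)) x ^ 2
      ≤ (2 / (d - s)) ^ 2 * ρ ^ (2 - s) *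
        ∫ x, D.indicator (fun x => φ' (u x)) x ^ 2 * ‖G x‖ ^ 2 := by
  obtain ⟨hf, hfc⟩ := continuous_indicator_comp hD hu h.pos h.continuous h.eq_zero
  have : Nonempty (Fin d) := ⟨⟨0, hd⟩⟩
  have hne : ∀ᵐ x : EuclideanSpace ℝ (Fin d), x ≠ 0 := by
    simp [ae_iff, measure_singleton]
  have hsupp : ∀ x, x ∉ Metric.ball 0 ρ → D.indicator (fun x => φ (u x)) x = 0 := fun x hx =>
    indicator_of_notMem (fun h => hx (hρ h)) _
  set f := D.indicator fun x => φ (u x)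
  obtain ⟨M, hM⟩ := hfc.exists_bound_of_continuous hf
  have int : Integrable fun x => ‖x‖ ^ (-s) * f x ^ 2 :=
    integrable_norm_rpow_mul hd hsd (M := M ^ 2) (ρ := ρ) (hf.pow 2).aestronglyMeasurable
      (fun x => by rw [abs_pow]; exact pow_le_pow_left₀ (abs_nonneg _) (hM x) 2)
      (fun x hx => by simp [hsupp x hx])
  have hκ : ∀ n : ℕ, 0 < 1 / ((n : ℝ) + 1) := fun n => by positivity
  -- Let κ = 1/(n+1) tend to 0. The limit integrand dominates, and it is integrable because s < d.
  have lim : Tendsto (fun n : ℕ => ∫ x, (‖x‖ ^ 2 + 1 / ((n : ℝ) + 1)) ^ (-s / 2) * f x ^ 2) atTop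
      (𝓝 (∫ x, ‖x‖ ^ (-s) * f x ^ 2)) := by
    refine tendsto_integral_of_dominated_convergence _
      (fun n => ((contDiff_regularized_rpow s (hκ n)).continuous.mul
        (hf.pow 2)).aestronglyMeasurable) int (fun n => ?_) ?_
    · filter_upwards [hne] with x hx
      rw [Real.norm_of_nonneg (by positivity)]
      gcongr
      exact regularized_rpow_le hs (hκ n).le (norm_pos_iff.2 hx)
    · filter_upwards [hne] with x hx
      have hx' : 0 < ‖x‖ := norm_pos_iff.2 hx
      refine Tendsto.mul_const _ ?_
      have h1 : Tendsto (fun n : ℕ => ‖x‖ ^ 2 + 1 / ((n : ℝ) + 1)) atTop (𝓝 (‖x‖ ^ 2)) := by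
        simpa using tendsto_one_div_add_atTop_nhds_zero_nat.const_add (‖x‖ ^ 2)
      have h2 := h1.rpow_const (p := -s / 2) (Or.inl (by positivity))
      have h3 : (‖x‖ ^ 2) ^ (-s / 2) = ‖x‖ ^ (-s) := by
        rw [← Real.rpow_natCast, ← Real.rpow_mul hx'.le]; congr 1; push_cast; ring
      rwa [h3] at h2
  exact le_of_tendsto' lim fun n => h.hardy_regularized hG hu hD hρ hs hs2 hsd (hκ n)

/-! ### An explicit truncation -/

lemma hasDerivAt_sq_posPart (t : ℝ) : HasDerivAt (fun t : ℝ => max t 0 ^ 2) (2 * max t 0) t := by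
  rcases lt_trichotomy t 0 with h | rfl | h
  · have : (fun t : ℝ => max t 0 ^ 2) =ᶠ[𝓝 t] fun _ => 0 := by
      filter_upwards [Iio_mem_nhds h] with y hy
      simp [max_eq_right (le_of_lt (mem_Iio.1 hy))]
    rw [max_eq_right h.le, mul_zero]
    exact (hasDerivAt_const t (0 : ℝ)).congr_of_eventuallyEq this
  · have : HasDerivAt (fun t : ℝ => t ^ 2) 0 0 := by simpa using hasDerivAt_pow 2 (0 : ℝ)
    rw [hasDerivAt_iff_isLittleO_nhds_zero] at this ⊢
    refine Asymptotics.IsBigO.trans_isLittleO ?_ this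
    refine Asymptotics.IsBigO.of_bound 1 (Eventually.of_forall fun y => ?_)
    rcases le_total y 0 with hy | hy
    · simp [max_eq_right hy, sq_nonneg]
    · simp [max_eq_left hy]
  · have : (fun t : ℝ => max t 0 ^ 2) =ᶠ[𝓝 t] fun t => t ^ 2 := by
      filter_upwards [Ioi_mem_nhds h] with y hy
      simp [max_eq_left (le_of_lt (mem_Ioi.1 hy))]
    rw [max_eq_left h.le]
    exact (by simpa using hasDerivAt_pow 2 t : HasDerivAt (fun t : ℝ => t ^ 2) (2 * t) t)
      |>.congr_of_eventuallyEq this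

/-- A `C¹` approximation of the positive part. -/
noncomputable def truncation (δ t : ℝ) : ℝ := √(max (t - δ) 0 ^ 2 + δ ^ 2) - δ

lemma isTruncation_truncation {δ : ℝ} (hδ : 0 < δ) :
    IsTruncation δ (truncation δ)
      (fun t => max (t - δ) 0 / √(max (t - δ) 0 ^ 2 + δ ^ 2)) where
  pos := hδ
  hasDerivAt t := by
    have h1 : HasDerivAt (fun t : ℝ => max (t - δ) 0 ^ 2 + δ ^ 2) (2 * max (t - δ) 0) t :=
      ((hasDerivAt_sq_posPart (t - δ)).comp_sub_const t δ).add_const _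
    refine ((h1.sqrt (by positivity)).sub_const δ).congr_deriv ?_
    rw [mul_div_mul_left _ _ two_ne_zero]
  continuous_deriv := by
    refine Continuous.div (by fun_prop) (by fun_prop) fun t => ?_
    positivity
  eq_zero t ht := by
    rw [truncation, max_eq_right (by linarith)]
    simp [Real.sqrt_sq hδ.le]
  deriv_nonneg t := by positivity
  deriv_le_one t := by
    rw [div_le_one (by positivity)]
    exact Real.le_sqrt_of_sq_le (by linarith [sq_nonneg δ])

lemma truncation_le {δ : ℝ} (hδ : 0 < δ) (t : ℝ) : truncation δ t ≤ max t 0 := by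
  have h1 : √(max (t - δ) 0 ^ 2 + δ ^ 2) ≤ max (t - δ) 0 + δ := by
    refine Real.sqrt_le_iff.2 ⟨by positivity, ?_⟩
    have : 0 ≤ max (t - δ) 0 * δ := by positivity
    nlinarith
  have h2 : max (t - δ) 0 ≤ max t 0 := max_le_max (by linarith) le_rfl
  unfold truncation
  linarith

lemma tendsto_truncation (t : ℝ) :
    Tendsto (fun n : ℕ => truncation (1 / ((n : ℝ) + 1)) t) atTop (𝓝 (max t 0)) := by
  have hc : Continuous fun δ => truncation δ t := by unfold truncation; fun_prop
  have := (hc.tendsto 0).comp tendsto_one_div_add_atTop_nhds_zero_nat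
  have h0 : truncation 0 t = max t 0 := by
    simp [truncation, Real.sqrt_sq (le_max_right t 0)]
  rwa [h0] at this

/-! ### The energy argument for eigenfunctions -/

lemma IsWeakGradient.neg {u : EuclideanSpace ℝ (Fin d) → ℝ}
    {G : EuclideanSpace ℝ (Fin d) → EuclideanSpace ℝ (Fin d)} (h : IsWeakGradient u G) :
    IsWeakGradient (-u) (-G) where
  locallyIntegrable := h.locallyIntegrable.neg
  locallyIntegrable_grad := h.locallyIntegrable_grad.neg
  integral_eq φ hφ hφc w := by
    simp only [Pi.neg_apply, neg_mul, inner_neg_left, integral_neg, h.integral_eq φ hφ hφc w]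

lemma IsEigenfunction.neg {v : ℝ → ℝ} {lam : ℝ} {u : EuclideanSpace ℝ (Fin d) → ℝ}
    (h : IsEigenfunction v lam u) : IsEigenfunction v lam (-u) where
  continuous := h.continuous.neg
  ne_zero h0 := h.ne_zero (by filter_upwards [h0] with x hx; simpa using hx)
  eigen := by
    obtain ⟨hf, G, ⟨hG, R, hR, hVR⟩, hform⟩ := h.eigen
    refine ⟨by simpa [Pi.neg_def] using hf.neg, -G,
      ⟨⟨hG.memLp.neg, hG.memLp_grad.neg, hG.isWeakGradient.neg⟩, R, hR, by simpa using hVR⟩,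
      fun φ Γ hφ => ?_⟩
    have := hform φ Γ hφ
    simp only [Pi.neg_apply, inner_neg_left, mul_neg, neg_mul, integral_neg]
    linarith

lemma aestronglyMeasurable_comp_norm [Nonempty (Fin d)] {v : ℝ → ℝ}
    (hv : ContinuousOn v (Ioi 0)) :
    AEStronglyMeasurable (fun x : EuclideanSpace ℝ (Fin d) => v ‖x‖) := by
  have h : ContinuousOn (fun x : EuclideanSpace ℝ (Fin d) => v ‖x‖) {0}ᶜ :=
    hv.comp continuous_norm.continuousOn fun x hx => norm_pos_iff.2 hx
  have h2 := h.aestronglyMeasurable (μ := volume) (measurableSet_singleton 0).compl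
  rwa [restrict_compl_singleton] at h2

/-- The energy estimate for the truncation of an eigenfunction to a nodal region contained in a
small ball. -/
lemma IsEigenfunction.weighted_le (hd : 2 ≤ d) {v : ℝ → ℝ} {lam : ℝ}
    {u : EuclideanSpace ℝ (Fin d) → ℝ} (h : IsEigenfunction v lam u)
    (hvc : ContinuousOn v (Ioi 0)) {s C ρ : ℝ} (hs : 0 ≤ s) (hs2 : s < 2) (hC : 0 < C)
    (hv : ∀ r, 0 < r → r < ρ → |v r| ≤ C * r ^ (-s))
    {D : Set (EuclideanSpace ℝ (Fin d))} (hD : IsNodalRegion u D) (hDρ : D ⊆ Metric.ball 0 ρ)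
    {δ : ℝ} {φ φ' : ℝ → ℝ} (hφ : IsTruncation δ φ φ') :
    ∫ x, (max lam 0 + C * ‖x‖ ^ (-s)) * D.indicator (fun x => φ (u x)) x ^ 2
      ≤ (max lam 0 * ((2 / d) ^ 2 * ρ ^ 2) + C * ((2 / (d - s)) ^ 2 * ρ ^ (2 - s))) *
        ∫ x, (max lam 0 + C * ‖x‖ ^ (-s)) * (u x * D.indicator (fun x => φ (u x)) x) := by
  have hu := h.continuous
  obtain ⟨-, G, ⟨hG, -⟩, hform⟩ := h.eigen
  have hd1 : 1 ≤ d := by omega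
  have hd2 : (2 : ℝ) ≤ d := by exact_mod_cast hd
  have hsd : s < d := by linarith
  have : Nonempty (Fin d) := ⟨⟨0, hd1⟩⟩
  have hne : ∀ᵐ x : EuclideanSpace ℝ (Fin d), x ≠ 0 := by simp [ae_iff, measure_singleton]
  have hardy_s := hφ.hardy hG hu hD hDρ hd1 hs hs2 hsd
  -- The exponent s = 0 gives the Poincaré inequality used for the λ⁺ part of the weight.
  have hardy_0 := hφ.hardy hG hu hD hDρ hd1 le_rfl two_pos (by linarith : (0 : ℝ) < d)
  simp only [neg_zero, Real.rpow_zero, one_mul, sub_zero, Real.rpow_two] at hardy_0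
  have hH1 := hφ.memH1With hG hu hD
  have hJ := hφ.integrable_sq_mul_norm_sq hG hu hD
  obtain ⟨hf, hfc⟩ := continuous_indicator_comp hD hu hφ.pos hφ.continuous hφ.eq_zero
  obtain ⟨hg, -⟩ := continuous_indicator_comp hD hu hφ.pos hφ.continuous_deriv
    fun t ht => hφ.deriv_eq_zero ht
  have hsupp : ∀ x, x ∉ Metric.ball 0 ρ → D.indicator (fun x => φ (u x)) x = 0 := fun x hx =>
    indicator_of_notMem (fun h => hx (hDρ h)) _
  have hg0 : ∀ x, 0 ≤ D.indicator (fun x => φ' (u x)) x := fun x =>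
    indicator_nonneg (fun x _ => hφ.deriv_nonneg _) x
  have hg1 : ∀ x, D.indicator (fun x => φ' (u x)) x ≤ 1 := fun x =>
    indicator_apply_le' (fun _ => hφ.deriv_le_one _) fun _ => zero_le_one
  have huf0 : ∀ x, 0 ≤ u x * D.indicator (fun x => φ (u x)) x := fun x => by
    by_cases hx : x ∈ D
    · rw [indicator_of_mem hx]
      rcases le_total (u x) δ with h' | h'
      · simp [hφ.eq_zero _ h']
      · exact mul_nonneg (hφ.pos.le.trans h') (hφ.nonneg _)
    · simp [indicator_of_notMem hx]
  set f := D.indicator fun x => φ (u x)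
  set g := D.indicator fun x => φ' (u x)
  have huf : Continuous fun x => u x * f x := hu.mul hf
  have hufc : HasCompactSupport fun x => u x * f x := hfc.mul_left
  obtain ⟨M, hM⟩ := hfc.exists_bound_of_continuous hf
  obtain ⟨N, hN⟩ := hufc.exists_bound_of_continuous huf
  have hfsq : HasCompactSupport fun x => f x ^ 2 :=
    hfc.comp_left (g := fun t : ℝ => t ^ 2) (by simp)
  have int_f2 : Integrable fun x => f x ^ 2 := (hf.pow 2).integrable_of_hasCompactSupport hfsq
  have int_sf2 : Integrable fun x => ‖x‖ ^ (-s) * f x ^ 2 :=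
    integrable_norm_rpow_mul hd1 hsd (M := M ^ 2) (ρ := ρ) (hf.pow 2).aestronglyMeasurable
      (fun x => by rw [abs_pow]; exact pow_le_pow_left₀ (abs_nonneg _) (hM x) 2)
      (fun x hx => by simp [hsupp x hx])
  have int_uf : Integrable fun x => u x * f x := huf.integrable_of_hasCompactSupport hufc
  have int_suf : Integrable fun x => ‖x‖ ^ (-s) * (u x * f x) :=
    integrable_norm_rpow_mul hd1 hsd (M := N) (ρ := ρ) huf.aestronglyMeasurable hN
      (fun x hx => by simp [hsupp x hx])
  have hVle : ∀ᵐ x : EuclideanSpace ℝ (Fin d),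
      |v ‖x‖ * u x * f x| ≤ C * (‖x‖ ^ (-s) * (u x * f x)) := by
    filter_upwards [hne] with x hx
    by_cases hxρ : x ∈ Metric.ball 0 ρ
    · rw [mul_assoc, abs_mul, abs_of_nonneg (huf0 x), ← mul_assoc C]
      exact mul_le_mul_of_nonneg_right (hv _ (norm_pos_iff.2 hx) (mem_ball_zero_iff.1 hxρ))
        (huf0 x)
    · simp [hsupp x hxρ]
  have int_V : Integrable fun x => v ‖x‖ * u x * f x :=
    (int_suf.const_mul C).mono' (((aestronglyMeasurable_comp_norm hvc).mul
      hu.aestronglyMeasurable).mul hf.aestronglyMeasurable) hVle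
  have hmem : MemFormDomainWith v f fun x => g x • G x := by
    -- The sign of ρ is not prescribed, hence a radius that is positive in any case; f vanishes
    -- outside this ball.
    refine ⟨hH1, |ρ| + 1, by positivity, ?_⟩
    have hz : IntegrableOn (fun _ : EuclideanSpace ℝ (Fin d) => (0 : ℝ))
        (Metric.ball 0 (|ρ| + 1))ᶜ := integrableOn_zero
    refine hz.congr_fun (fun x hx => ?_) measurableSet_ball.compl
    have : f x = 0 := hsupp x fun hx' => hx (by
      rw [mem_ball_zero_iff] at hx' ⊢
      linarith [le_abs_self ρ])
    simp [this]
  have energy := hform f _ hmem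
  have int_g : Integrable fun x => inner ℝ (G x) (g x • G x) := by
    have := hG.memLp_grad.norm.integrable_sq.mul_bdd (c := 1) hg.aestronglyMeasurable
      (Eventually.of_forall fun x => by rw [Real.norm_of_nonneg (hg0 x)]; exact hg1 x)
    refine this.congr (Eventually.of_forall fun x => ?_)
    simp only [real_inner_smul_right, real_inner_self_eq_norm_sq]
    ring
  -- The energy of the truncation carries φ'², the tested equation only φ'; they compare because 0 ≤
  -- φ' ≤ 1.
  have step1 : ∫ x, g x ^ 2 * ‖G x‖ ^ 2 ≤ ∫ x, inner ℝ (G x) (g x • G x) := by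
    refine integral_mono hJ int_g fun x => ?_
    simp only [real_inner_smul_right, real_inner_self_eq_norm_sq]
    have : g x ^ 2 ≤ g x := by nlinarith [hg0 x, hg1 x]
    gcongr
  have int_h : Integrable fun x => (max lam 0 + C * ‖x‖ ^ (-s)) * (u x * f x) := by
    refine ((int_uf.const_mul (max lam 0)).add (int_suf.const_mul C)).congr
      (Eventually.of_forall fun x => ?_)
    simp only [Pi.add_apply]
    ring
  have step2 : ∫ x, inner ℝ (G x) (g x • G x)
      ≤ ∫ x, (max lam 0 + C * ‖x‖ ^ (-s)) * (u x * f x) := by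
    have e : ∫ x, inner ℝ (G x) (g x • G x)
        = ∫ x, (lam * u x * f x - v ‖x‖ * u x * f x) := by
      rw [integral_sub (by simpa only [mul_assoc] using int_uf.const_mul lam) int_V]
      linarith
    rw [e]
    refine integral_mono_ae ((by simpa only [mul_assoc] using int_uf.const_mul lam :
      Integrable fun x => lam * u x * f x).sub int_V) int_h ?_
    filter_upwards [hVle] with x hx
    have h1 := neg_le_of_abs_le hx
    have h2 := mul_le_mul_of_nonneg_right (le_max_left lam 0) (huf0 x)
    linarith
  have step3 : ∫ x, (max lam 0 + C * ‖x‖ ^ (-s)) * f x ^ 2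
      = max lam 0 * (∫ x, f x ^ 2) + C * ∫ x, ‖x‖ ^ (-s) * f x ^ 2 := by
    rw [← integral_const_mul, ← integral_const_mul,
      ← integral_add (int_f2.const_mul _) (int_sf2.const_mul _)]
    refine integral_congr_ae (Eventually.of_forall fun x => ?_)
    simp only
    ring
  -- A nonempty `D` forces ρ to be positive; for empty `D` both sides vanish.
  have hρ : 0 ≤ ρ ^ (2 - s) ∨ D = ∅ := by
    rcases D.eq_empty_or_nonempty with hD | ⟨x, hx⟩
    · exact Or.inr hD
    · exact Or.inl (Real.rpow_nonneg ((norm_nonneg x).trans (mem_ball_zero_iff.1 (hDρ hx)).le) _)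
  rcases hρ with hρ | hρ
  · rw [step3]
    calc _ ≤ max lam 0 * ((2 / d) ^ 2 * ρ ^ 2 * ∫ x, g x ^ 2 * ‖G x‖ ^ 2)
          + C * ((2 / (d - s)) ^ 2 * ρ ^ (2 - s) * ∫ x, g x ^ 2 * ‖G x‖ ^ 2) := by
          gcongr
      _ = (max lam 0 * ((2 / d) ^ 2 * ρ ^ 2) + C * ((2 / (d - s)) ^ 2 * ρ ^ (2 - s)))
          * ∫ x, g x ^ 2 * ‖G x‖ ^ 2 := by ring
      _ ≤ _ := by
          exact mul_le_mul_of_nonneg_left (step1.trans step2) (by positivity)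
  · have : f = 0 := by simp only [f, hρ, indicator_empty]; rfl
    simp [this]

/-- If `|v(r)| ≤ C r^{-s}` for `r < ρ`, no nodal domain on which `u` takes a positive value is
contained in a ball of small radius `ρ`. -/
lemma IsEigenfunction.not_subset_ball_of_pos (hd : 2 ≤ d) {v : ℝ → ℝ} {lam : ℝ}
    {u : EuclideanSpace ℝ (Fin d) → ℝ} (h : IsEigenfunction v lam u)
    (hvc : ContinuousOn v (Ioi 0)) {s C ρ : ℝ} (hs : 0 ≤ s) (hs2 : s < 2) (hC : 0 < C)
    (hv : ∀ r, 0 < r → r < ρ → |v r| ≤ C * r ^ (-s))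
    (hsmall : max lam 0 * ((2 / d) ^ 2 * ρ ^ 2) + C * ((2 / (d - s)) ^ 2 * ρ ^ (2 - s)) < 1)
    {D : Set (EuclideanSpace ℝ (Fin d))} (hD : IsNodalRegion u D)
    {x₀ : EuclideanSpace ℝ (Fin d)} (hx₀ : x₀ ∈ D) (hux₀ : 0 < u x₀) :
    ¬ D ⊆ Metric.ball 0 ρ := by
  intro hDρ
  have hu := h.continuous
  have hd1 : 1 ≤ d := by omega
  have hd2 : (2 : ℝ) ≤ d := by exact_mod_cast hd
  have hsd : s < d := by linarith
  have : Nonempty (Fin d) := ⟨⟨0, hd1⟩⟩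
  have hne : ∀ᵐ x : EuclideanSpace ℝ (Fin d), x ≠ 0 := by simp [ae_iff, measure_singleton]
  set p := D.indicator fun x => max (u x) 0 with hp
  have hpm : AEStronglyMeasurable p :=
    (hu.max continuous_const).aestronglyMeasurable.indicator hD.isOpen.measurableSet
  obtain ⟨M, hM⟩ := hD.isBounded.isCompact_closure.exists_bound_of_continuousOn hu.continuousOn
  have hM0 : 0 ≤ M := (norm_nonneg _).trans (hM x₀ (subset_closure hx₀))
  have hpM : ∀ x, |p x ^ 2| ≤ M ^ 2 := fun x => by
    rw [abs_pow]
    refine pow_le_pow_left₀ (abs_nonneg _) ?_ 2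
    by_cases hx : x ∈ D
    · rw [hp, indicator_of_mem hx, abs_of_nonneg (le_max_right _ _)]
      exact max_le ((le_abs_self _).trans (hM x (subset_closure hx))) hM0
    · simpa [hp, indicator_of_notMem hx] using hM0
  have hp0 : ∀ x, x ∉ Metric.ball 0 ρ → p x ^ 2 = 0 := fun x hx => by
    rw [hp, indicator_of_notMem fun h => hx (hDρ h)]; simp
  set w : EuclideanSpace ℝ (Fin d) → ℝ := fun x => max lam 0 + C * ‖x‖ ^ (-s) with hw
  have hw0 : ∀ x, 0 ≤ w x := fun x => by simp only [hw]; positivity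
  have hwm : AEStronglyMeasurable w :=
    (measurable_const.add ((measurable_norm.pow_const _).const_mul C)).aestronglyMeasurable
  have int : Integrable fun x => w x * p x ^ 2 := by
    have h0 : Integrable fun x : EuclideanSpace ℝ (Fin d) => ‖x‖ ^ (-(0 : ℝ)) * p x ^ 2 :=
      integrable_norm_rpow_mul hd1 (by linarith) (hpm.pow 2) hpM hp0
    have h1 : Integrable fun x : EuclideanSpace ℝ (Fin d) => ‖x‖ ^ (-s) * p x ^ 2 :=
      integrable_norm_rpow_mul hd1 hsd (hpm.pow 2) hpM hp0
    refine ((h0.const_mul (max lam 0)).add (h1.const_mul C)).congr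
      (Eventually.of_forall fun x => ?_)
    simp [hw]
    ring
  let f : ℕ → EuclideanSpace ℝ (Fin d) → ℝ := fun n =>
    D.indicator fun x => truncation (1 / ((n : ℝ) + 1)) (u x)
  have hδ : ∀ n : ℕ, 0 < 1 / ((n : ℝ) + 1) := fun n => by positivity
  have hft : ∀ x, Tendsto (fun n => f n x) atTop (𝓝 (p x)) := fun x => by
    by_cases hx : x ∈ D
    · simpa only [f, hp, indicator_of_mem hx] using tendsto_truncation (u x)
    · simp only [f, hp, indicator_of_notMem hx]; exact tendsto_const_nhds
  have hfm : ∀ n, Continuous (f n) := fun n =>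
    (continuous_indicator_comp hD hu (hδ n) (isTruncation_truncation (hδ n)).continuous
      (isTruncation_truncation (hδ n)).eq_zero).1
  have hf0 : ∀ n x, 0 ≤ f n x := fun n x =>
    indicator_nonneg (fun x _ => (isTruncation_truncation (hδ n)).nonneg _) x
  have hfp : ∀ n x, f n x ≤ p x := fun n x =>
    indicator_le_indicator (truncation_le (hδ n) (u x))
  have hup : ∀ x, u x * p x = p x ^ 2 := fun x => by
    by_cases hx : x ∈ D
    · rw [hp, indicator_of_mem hx]
      rcases le_total (u x) 0 with h' | h'
      · simp [max_eq_right h']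
      · rw [max_eq_left h']; ring
    · simp [hp, indicator_of_notMem hx]
  have huf : ∀ n x, |u x * f n x| ≤ p x ^ 2 := fun n x => by
    by_cases hx : x ∈ D
    · rcases le_total (u x) 0 with h' | h'
      · have : f n x = 0 := by
          simp only [f, indicator_of_mem hx]
          exact (isTruncation_truncation (hδ n)).eq_zero _ (h'.trans (hδ n).le)
        rw [this]; simpa using sq_nonneg (p x)
      · rw [abs_of_nonneg (mul_nonneg h' (hf0 n x)), ← hup x]
        exact mul_le_mul_of_nonneg_left (hfp n x) h'
    · simp [f, hp, indicator_of_notMem hx]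
  have lim1 : Tendsto (fun n => ∫ x, w x * f n x ^ 2) atTop (𝓝 (∫ x, w x * p x ^ 2)) := by
    refine tendsto_integral_of_dominated_convergence _
      (fun n => hwm.mul ((hfm n).pow 2).aestronglyMeasurable) int
      (fun n => Eventually.of_forall fun x => ?_)
      (Eventually.of_forall fun x => ((hft x).pow 2).const_mul _)
    rw [Real.norm_of_nonneg (mul_nonneg (hw0 x) (sq_nonneg _))]
    exact mul_le_mul_of_nonneg_left (pow_le_pow_left₀ (hf0 n x) (hfp n x) 2) (hw0 x)
  have lim2 : Tendsto (fun n => ∫ x, w x * (u x * f n x)) atTop (𝓝 (∫ x, w x * p x ^ 2)) := by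
    refine tendsto_integral_of_dominated_convergence _
      (fun n => hwm.mul (hu.mul (hfm n)).aestronglyMeasurable) int
      (fun n => Eventually.of_forall fun x => ?_)
      (Eventually.of_forall fun x => ?_)
    · rw [norm_mul, Real.norm_of_nonneg (hw0 x)]
      exact mul_le_mul_of_nonneg_left (huf n x) (hw0 x)
    · rw [← hup x]
      exact ((hft x).const_mul _).const_mul _
  -- As δ tends to 0 both sides converge to multiples of the same integral of w p², so a factor
  -- below 1 forces it to vanish.
  have hle := le_of_tendsto_of_tendsto' lim1 (lim2.const_mul _) fun n =>
    h.weighted_le hd hvc hs hs2 hC hv hD hDρ (isTruncation_truncation (hδ n))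
  have hnn : 0 ≤ ∫ x, w x * p x ^ 2 := integral_nonneg fun x => mul_nonneg (hw0 x) (sq_nonneg _)
  have hzero : ∫ x, w x * p x ^ 2 = 0 := by nlinarith
  rw [integral_eq_zero_iff_of_nonneg (fun x => mul_nonneg (hw0 x) (sq_nonneg _)) int] at hzero
  -- The contradiction: p > 0 on a nonempty open set, while w p² = 0 almost everywhere and w > 0
  -- away from the origin.
  have hpos : 0 < volume (D ∩ {x | 0 < u x}) :=
    (hD.isOpen.inter (isOpen_lt continuous_const hu)).measure_pos volume ⟨x₀, hx₀, hux₀⟩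
  refine hpos.ne' (measure_mono_null (fun x hx => ?_) (ae_iff.1 (hzero.and hne)))
  rintro ⟨h1, h2⟩
  have hwx : 0 < w x := by
    have := Real.rpow_pos_of_pos (norm_pos_iff.2 h2) (-s)
    have h3 : 0 ≤ max lam 0 := le_max_right _ _
    simp only [hw]; positivity
  have hpx : 0 < p x := by
    rw [hp, indicator_of_mem hx.1]; exact lt_max_of_lt_left hx.2
  exact (mul_pos hwx (pow_pos hpx 2)).ne' h1

lemma IsEigenfunction.not_subset_ball (hd : 2 ≤ d) {v : ℝ → ℝ} {lam : ℝ}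
    {u : EuclideanSpace ℝ (Fin d) → ℝ} (h : IsEigenfunction v lam u)
    (hvc : ContinuousOn v (Ioi 0)) {s C ρ : ℝ} (hs : 0 ≤ s) (hs2 : s < 2) (hC : 0 < C)
    (hv : ∀ r, 0 < r → r < ρ → |v r| ≤ C * r ^ (-s))
    (hsmall : max lam 0 * ((2 / d) ^ 2 * ρ ^ 2) + C * ((2 / (d - s)) ^ 2 * ρ ^ (2 - s)) < 1)
    {D : Set (EuclideanSpace ℝ (Fin d))} (hD : IsNodalDomain u D) :
    ¬ D ⊆ Metric.ball 0 ρ := by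
  intro hDρ
  have hb : Bornology.IsBounded D := Metric.isBounded_ball.subset hDρ
  obtain ⟨x₀, hx₀, hD'⟩ := hD
  have hmem : x₀ ∈ D := hD' ▸ mem_connectedComponentIn hx₀
  rcases lt_or_gt_of_ne hx₀ with hneg | hpos
  · have hN : IsNodalDomain (-u) D := ⟨x₀, by simpa using hx₀, by simpa using hD'⟩
    exact h.neg.not_subset_ball_of_pos hd hvc hs hs2 hC hv hsmall
      (hN.isNodalRegion h.neg.continuous hb) hmem (by simpa using hneg) hDρ
  · exact h.not_subset_ball_of_pos hd hvc hs hs2 hC hv hsmall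
      (IsNodalDomain.isNodalRegion h.continuous ⟨x₀, hx₀, hD'⟩ hb) hmem hpos hDρ

/-! ### Choice of the radius -/

/-- Puts the two behaviours at 0 on the same footing: a continuous profile is the case s = 0. -/
lemma RadialProfile.exists_bound {v : ℝ → ℝ} (h : RadialProfile v) :
    ∃ s C ρ : ℝ, 0 ≤ s ∧ s < 2 ∧ 0 < C ∧ 0 < ρ ∧
      ∀ r, 0 < r → r < ρ → |v r| ≤ C * r ^ (-s) := by
  rcases h.at_zero with hc | ⟨s, hs, hs2, C, hC, hev⟩
  · obtain ⟨C, hC⟩ := (isCompact_Icc (a := (0 : ℝ)) (b := 1)).exists_bound_of_continuousOn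
      (hc.mono Icc_subset_Ici_self)
    refine ⟨0, |C| + 1, 1, le_rfl, two_pos, by positivity, one_pos, fun r h0 h1 => ?_⟩
    have := hC r ⟨h0.le, h1.le⟩
    rw [Real.norm_eq_abs] at this
    simp only [neg_zero, Real.rpow_zero, mul_one]
    linarith [le_abs_self C]
  · obtain ⟨ρ, hρ, hsub⟩ := mem_nhdsGT_iff_exists_Ioo_subset.1 hev
    refine ⟨s, C, ρ, hs.le, hs2, hC, hρ, fun r h0 h1 => ?_⟩
    obtain ⟨hl, hr⟩ := hsub ⟨h0, h1⟩
    have hpos : 0 < r ^ (-s) := Real.rpow_pos_of_pos h0 _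
    -- The lower bound 1/C makes the ratio positive, so it equals |v r| / r^(-s) and the upper bound
    -- C applies.
    have h2 : 0 < v r / -r ^ (-s) := (by positivity : 0 < 1 / C).trans_le hl
    have h3 : |v r| = v r / -r ^ (-s) * r ^ (-s) := by
      have h4 : v r = v r / -r ^ (-s) * -r ^ (-s) := by field_simp
      conv_lhs => rw [h4]
      rw [abs_mul, abs_of_pos h2, abs_neg, abs_of_pos hpos]
    rw [h3]
    gcongr

lemma RadialProfile.exists_radius_of_large (hd : 2 ≤ d) {v : ℝ → ℝ} (h : RadialProfile v) :
    ∃ c : ℝ, 0 < c ∧ ∃ lam₀ : ℝ, 1 ≤ lam₀ ∧ ∀ lam : ℝ, lam₀ ≤ lam →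
      ∀ u : EuclideanSpace ℝ (Fin d) → ℝ, IsEigenfunction v lam u →
      ∀ D : Set (EuclideanSpace ℝ (Fin d)), IsNodalDomain u D →
        ¬ D ⊆ Metric.ball 0 (c * lam ^ (-(1 / 2) : ℝ)) := by
  obtain ⟨s, C, ρ₀, hs, hs2, hC, hρ₀, hv⟩ := h.exists_bound
  have hd2 : (2 : ℝ) ≤ d := by exact_mod_cast hd
  have t1 : Tendsto (fun lam : ℝ => 1 / 2 * lam ^ (-(1 / 2) : ℝ)) atTop (𝓝 0) := by
    simpa using (tendsto_rpow_neg_atTop (y := (1 / 2 : ℝ)) (by norm_num)).const_mul (1 / 2 : ℝ)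
  have t2 : Tendsto (fun lam : ℝ => C * ((2 / (d - s)) ^ 2 *
      (1 / 2 * lam ^ (-(1 / 2) : ℝ)) ^ (2 - s))) atTop (𝓝 0) := by
    have := t1.rpow_const (p := 2 - s) (Or.inr (by linarith))
    rw [Real.zero_rpow (by linarith)] at this
    simpa using (this.const_mul ((2 / (d - s)) ^ 2)).const_mul C
  obtain ⟨lam₀, hlam₀⟩ := eventually_atTop.1
    ((t1.eventually (gt_mem_nhds hρ₀)).and (t2.eventually (gt_mem_nhds one_half_pos)))
  -- With c = 1/2 the λ⁺ term equals 1/d² ≤ 1/4, and the singular term is below 1/2 for large λ, so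
  -- the sum is below 1. The threshold at least 1 also serves to compare powers of λ in the planar
  -- case.
  refine ⟨1 / 2, one_half_pos, max lam₀ 1, le_max_right _ _, fun lam hlam u hu D hD => ?_⟩
  obtain ⟨h1, h2⟩ := hlam₀ lam ((le_max_left _ _).trans hlam)
  have hlpos : 0 < lam := one_pos.trans_le ((le_max_right _ _).trans hlam)
  refine hu.not_subset_ball hd h.contDiffOn.continuousOn hs hs2 hC
    (fun r hr0 hr => hv r hr0 (hr.trans h1)) ?_ hD
  have h3 : (lam ^ (-(1 / 2) : ℝ)) ^ 2 = lam⁻¹ := by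
    rw [← Real.rpow_natCast, ← Real.rpow_mul hlpos.le, ← Real.rpow_neg_one]
    norm_num
  have h4 : max lam 0 * ((2 / d) ^ 2 * (1 / 2 * lam ^ (-(1 / 2) : ℝ)) ^ 2) = (1 / (d : ℝ)) ^ 2 := by
    rw [max_eq_left hlpos.le, mul_pow, h3]
    field_simp
  have h5 : (1 / (d : ℝ)) ^ 2 ≤ (1 / 2) ^ 2 := by gcongr
  linarith

/-- For λ < 0 the weight loses its λ⁺ term, so smallness is a condition on the radius alone, uniform
in λ. -/
lemma RadialProfile.exists_radius_of_neg (hd : 2 ≤ d) {v : ℝ → ℝ} (h : RadialProfile v) :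
    ∃ r : ℝ, 0 < r ∧ ∀ lam : ℝ, lam < 0 →
      ∀ u : EuclideanSpace ℝ (Fin d) → ℝ, IsEigenfunction v lam u →
      ∀ D : Set (EuclideanSpace ℝ (Fin d)), IsNodalDomain u D → ¬ D ⊆ Metric.ball 0 r := by
  obtain ⟨s, C, ρ₀, hs, hs2, hC, hρ₀, hv⟩ := h.exists_bound
  have t : Tendsto (fun r : ℝ => C * ((2 / (d - s)) ^ 2 * r ^ (2 - s))) (𝓝[>] 0) (𝓝 0) := by
    have := (tendsto_id.mono_left nhdsWithin_le_nhds : Tendsto id (𝓝[>] (0 : ℝ)) (𝓝 0)).rpow_const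
      (p := 2 - s) (Or.inr (by linarith))
    rw [Real.zero_rpow (by linarith)] at this
    simpa using (this.const_mul ((2 / (d - s)) ^ 2)).const_mul C
  obtain ⟨r, h1, h2, h3⟩ := ((t.eventually (gt_mem_nhds one_pos)).and
    (Ioo_mem_nhdsGT hρ₀)).exists
  refine ⟨r, h2, fun lam hlam u hu D hD => ?_⟩
  refine hu.not_subset_ball hd h.contDiffOn.continuousOn hs hs2 hC
    (fun q hq0 hq => hv q hq0 (hq.trans h3)) ?_ hD
  rw [max_eq_right hlam.le]
  linarith

end RadialSchrodinger

theorem proposition3p5 (d : ℕ) (hd : 2 ≤ d) (v : ℝ → ℝ) :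
    (RadialSchrodinger.CaseA v ∨ RadialSchrodinger.CaseB v →
      RadialSchrodinger.SingularAtZero v →
      (3 ≤ d → ∃ c : ℝ, 0 < c ∧ ∃ lam₀ : ℝ, 0 < lam₀ ∧ ∀ lam : ℝ, lam₀ ≤ lam →
        ∀ u : EuclideanSpace ℝ (Fin d) → ℝ, RadialSchrodinger.IsEigenfunction v lam u →
        ∀ D : Set (EuclideanSpace ℝ (Fin d)), RadialSchrodinger.IsNodalDomain u D →
          ¬ D ⊆ Metric.ball 0 (c * lam ^ (-(1 / 2) : ℝ))) ∧
      (d = 2 → ∃ c : ℝ, 0 < c ∧ ∀ ε : ℝ, 0 < ε → ∃ lamε : ℝ, 0 < lamε ∧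
        ∀ lam : ℝ, lamε ≤ lam →
        ∀ u : EuclideanSpace ℝ (Fin d) → ℝ, RadialSchrodinger.IsEigenfunction v lam u →
        ∀ D : Set (EuclideanSpace ℝ (Fin d)), RadialSchrodinger.IsNodalDomain u D →
          ¬ D ⊆ Metric.ball 0 (c * lam ^ (-(1 / 2) - ε : ℝ)))) ∧
    (RadialSchrodinger.CaseB v →
      ∃ r : ℝ, 0 < r ∧ ∀ lam : ℝ, lam < 0 →
        ∀ u : EuclideanSpace ℝ (Fin d) → ℝ, RadialSchrodinger.IsEigenfunction v lam u →
        ∀ D : Set (EuclideanSpace ℝ (Fin d)), RadialSchrodinger.IsNodalDomain u D →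
          ¬ D ⊆ Metric.ball 0 r) := by
  refine ⟨fun hcase _ => ?_, fun hB => hB.1.exists_radius_of_neg hd⟩
  have hv : RadialSchrodinger.RadialProfile v := hcase.elim (fun h => h.1) fun h => h.1
  obtain ⟨c, hc, lam₀, hlam₀, hmain⟩ := hv.exists_radius_of_large hd
  refine ⟨fun _ => ⟨c, hc, lam₀, one_pos.trans_le hlam₀, hmain⟩, fun _ => ⟨c, hc, fun ε hε =>
    ⟨lam₀, one_pos.trans_le hlam₀, fun lam hlam u hu D hD hsub => ?_⟩⟩⟩
  -- For λ ≥ 1 the ball of radius c λ^(-1/2-ε) lies in that of radius c λ^(-1/2).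
  refine hmain lam hlam u hu D hD (hsub.trans (Metric.ball_subset_ball ?_))
  gcongr
  · exact hlam₀.trans hlam
  · linarith
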